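/- Let $\Gamma$ be the Gamma function. All parameters below are positive integers, all products are infinite products of formal power series in $q$, which converge, $a_n$ denotes the coefficient of $q^n$ in the product under consideration, and $a_n\sim A_n$ means $a_n/A_n\to1$ as $n\to\infty$. **Powers.** Let $s,t,m\ge 1$ with $\gcd(s,t)=1$. 1. For $\displaystyle\prod_{k\ge0}\frac1{(1-q^{sk+t})^m}$, $$a_n\sim\Gamma\!\left(\tfrac ts\right)^m 2^{-\frac{m+5}4-\frac{mt}{2s}}\,3^{\frac{m-1}4-\frac{mt}{2s}}\,m^{-\frac{m-1}4+\frac{mt}{2s}}\,s^{-\frac{m+1}4+\frac{mt}{2s}}\,\pi^{-m+\frac{mt}s}\,n^{\frac{m-3}4-\frac{mt}{2s}}\exp\!\left(\pi\sqrt{\tfrac{2mn}{3s}}\right).$$ 2. For $\displaystyle\prod_{k\ge0}(1+q^{sk+t})^m$, $$a_n\sim\frac{2^{\frac{m-3}2-\frac{mt}s}\,m^{1/4}}{(3s)^{1/4}\,n^{3/4}}\exp\!\left(\pi\sqrt{\tfrac{mn}{3s}}\right).$$ 3. For $\displaystyle\prod_{k\ge0}\left(\frac{1+q^{sk+t}}{1-q^{sk+t}}\right)^m$,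 $$a_n\sim\Gamma\!\left(\tfrac ts\right)^m 2^{\frac m2-\frac32-\frac{2tm}s}\,s^{-\frac m4-\frac14+\frac{tm}{2s}}\,m^{\frac14-\frac m4+\frac{tm}{2s}}\,\pi^{\frac{tm}s-m}\,n^{\frac m4-\frac34-\frac{tm}{2s}}\exp\!\left(\pi\sqrt{\tfrac{mn}s}\right).$$ **Convolutions.** Let $s,t,c,d\ge1$ with $\gcd(s,t,c,d)=1$. 4. For $\displaystyle\prod_{k\ge0}\frac1{(1-q^{sk+t})(1-q^{ck+d})}$, $$a_n\sim\frac{\Gamma\!\left(\frac ts\right)\Gamma\!\left(\frac dc\right)s^{\frac t{2s}-\frac d{2c}-\frac14}\,c^{\frac d{2c}-\frac t{2s}-\frac14}\,(s+c)^{\frac t{2s}+\frac d{2c}-\frac14}\,\pi^{\frac ts+\frac dc-2}}{2^{\frac t{2s}+\frac d{2c}+\frac74}\,3^{\frac t{2s}+\frac d{2c}-\frac14}\,n^{\frac14+\frac t{2s}+\frac d{2c}}}\exp\!\left(\pi\sqrt{\left(\tfrac1s+\tfrac1c\right)\tfrac{2n}3}\right).$$ 5. For $\displaystyle\prod_{k\ge0}(1+q^{sk+t})(1+q^{ck+d})$,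 $$a_n\sim\frac{(s+c)^{1/4}}{2^{\frac12+\frac ts+\frac dc}\,(3sc)^{1/4}\,n^{3/4}}\exp\!\left(\pi\sqrt{\left(\tfrac1s+\tfrac1c\right)\tfrac n3}\right).$$ 6. For $\displaystyle\prod_{k\ge0}\frac{1+q^{sk+t}}{1-q^{ck+d}}$, $$a_n\sim\frac{c^{\frac d{2c}-\frac12}\,(c+2s)^{\frac d{2c}}\,\pi^{\frac dc-1}\,\Gamma\!\left(\frac dc\right)}{2^{\frac dc+\frac{s+t}s}\,3^{\frac d{2c}}\,s^{\frac d{2c}}\,n^{\frac{c+d}{2c}}}\exp\!\left(\pi\sqrt{\left(\tfrac2c+\tfrac1s\right)\tfrac n3}\right).$$ -/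

import Mathlib

open Real Filter Asymptotics PowerSeries
open scoped PowerSeries.WithPiTopology

/-- The infinite product `∏_{k ≥ 0} f k` of formal power series in the variable `q` (written `X`)
converges (coefficientwise, unconditionally) to a series `∑ aₙ qⁿ` whose coefficients satisfy
`aₙ ~ A n` as `n → ∞`. The product, being a limit in a Hausdorff space, is unique. -/
def ProductCoeffAsymptotic (f : ℕ → ℝ⟦X⟧) (A : ℕ → ℝ) : Prop :=
  ∃ g : ℝ⟦X⟧, HasProd f g ∧ (fun n : ℕ => coeff n g) ~[atTop] A

open scoped Topology

/-! ### Riemann sums on a half-line -/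

/-! All six products are finite products over `i` of `∏ₖ 1/(1-q^(sᵢk+tᵢ))` or `∏ₖ (1+q^(sᵢk+tᵢ))`,
so one general asymptotic, `productCoeffAsymptotic_prodFactor`, covers them. Write `F(x)` for the
value of the product at `q = e^{-x}`. The proof has three ingredients.

Growth on the positive axis: `F(x) ~ C x^(-D) e^(B/x)` as `x → 0+`. The logarithm of one progression
is a Lambert-type sum. With its singular part at the origin removed, it becomes a Riemann sum and
converges to a constant (`tendsto_logQPoch_const`). That constant is identified as a function of `a
= t/s` by the Bohr-Mollerup theorem and normalised by a duplication identity (`tendsto_logQPoch`).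
The factors `1+q^N = (1-q^(2N))/(1-q^N)` follow by subtraction.

Local limit theorem: give `m` the probability `a_m e^{-xm}/F(x)`. Tilting by an exponential only
changes `x`, so the growth of `F` alone shows that `(m - B/x²) x^(3/2)` has moment generating
function tending to `e^(Bu²)`. This passes to characteristic functions
(`tendsto_tsum_cexp_of_tendsto_tsum_exp`). Fourier inversion at `x = √(B/n)`, where the centre is
exactly `n`, gives `a_n` (`isEquivalent_of_boltzmann`).

Decay off the axis: the inversion integral needs the bound `|F(x-iθ)| ≤ F(x) exp(-c min(1/x,
θ²/x³))` for `|θ| ≤ π`. Each factor loses `exp(-e^{-xN}(1-cos Nθ)/5)`, and the total loss is large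
because the `sᵢ` and `tᵢ` have no common divisor (`exists_min_le_sum_exp_mul_one_sub_cos`). -/

theorem tendsto_tsum_mul_nhdsGT_zero {G : ℝ → ℝ} {C : ℝ} (hG : ContinuousOn G (Set.Ioi 0))
    (hC : ∀ y, 0 < y → |G y| ≤ C * (1 + y ^ 2)⁻¹) :
    Tendsto (fun x : ℝ => ∑' j : ℕ, x * G (((j : ℝ) + 1) * x)) (𝓝[>] 0)
      (𝓝 (∫ u in Set.Ioi (0 : ℝ), G u)) := by
  have hC0 : 0 ≤ C := by
    have h := (abs_nonneg _).trans (hC 1 one_pos)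
    norm_num at h; linarith
  -- The sum is the integral of the step function that takes on each cell `[jx, (j+1)x)` the value
  -- of `G` at the right endpoint. That endpoint exceeds `u`, so the decreasing majorant evaluated
  -- at `u` dominates for every `x`.
  set H : ℝ → ℝ → ℝ := fun x u => G (((⌊u / x⌋₊ : ℝ) + 1) * x) with hH
  have hpt (x u : ℝ) (hx : 0 < x) (hu : 0 < u) :
      u < ((⌊u / x⌋₊ : ℝ) + 1) * x ∧ ((⌊u / x⌋₊ : ℝ) + 1) * x ≤ u + x := by
    have h1 := Nat.lt_floor_add_one (u / x)
    have h2 := Nat.floor_le (div_pos hu hx).le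
    rw [div_lt_iff₀ hx] at h1
    rw [le_div_iff₀ hx] at h2
    exact ⟨h1, by linarith⟩
  have hbd (x u : ℝ) (hx : 0 < x) (hu : 0 < u) : ‖H x u‖ ≤ C * (1 + u ^ 2)⁻¹ := by
    obtain ⟨h1, -⟩ := hpt x u hx hu
    refine (hC _ (hu.trans h1)).trans ?_
    gcongr
  have hint : MeasureTheory.IntegrableOn (fun u : ℝ => C * (1 + u ^ 2)⁻¹) (Set.Ioi 0) :=
    (integrable_inv_one_add_sq.const_mul C).integrableOn
  have hmeas (x : ℝ) (hx : 0 < x) :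
      MeasureTheory.AEStronglyMeasurable (H x) (MeasureTheory.volume.restrict (Set.Ioi 0)) := by
    have hd : Measurable (fun n : ℕ => G (((n : ℝ) + 1) * x)) := measurable_from_top
    have hf : Measurable (fun u : ℝ => ⌊u / x⌋₊) := Nat.measurable_floor.comp (by fun_prop)
    exact (hd.comp hf).aestronglyMeasurable
  have hsum (x : ℝ) (hx : 0 < x) :
      ∑' j : ℕ, x * G (((j : ℝ) + 1) * x) = ∫ u in Set.Ioi (0 : ℝ), H x u := by
    have hU : (⋃ j : ℕ, Set.Ico (j * x) (((j : ℝ) + 1) * x)) = Set.Ici 0 := by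
      ext u
      simp only [Set.mem_iUnion, Set.mem_Ico, Set.mem_Ici]
      constructor
      · rintro ⟨j, h1, -⟩
        exact le_trans (by positivity) h1
      · intro hu
        refine ⟨⌊u / x⌋₊, ?_, ?_⟩
        · rw [← le_div_iff₀ hx]; exact Nat.floor_le (by positivity)
        · rw [← div_lt_iff₀ hx]; exact Nat.lt_floor_add_one _
    have hfl (j : ℕ) (u : ℝ) (hu : u ∈ Set.Ico (j * x) (((j : ℝ) + 1) * x)) : ⌊u / x⌋₊ = j := by
      rw [Nat.floor_eq_iff (div_nonneg (le_trans (by positivity) hu.1) hx.le)]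
      rw [le_div_iff₀ hx, div_lt_iff₀ hx]
      exact hu
    have hI : MeasureTheory.IntegrableOn (H x) (Set.Ici 0) := by
      rw [integrableOn_Ici_iff_integrableOn_Ioi]
      refine MeasureTheory.Integrable.mono' hint (hmeas x hx) ?_
      filter_upwards [MeasureTheory.ae_restrict_mem measurableSet_Ioi] with u hu
      exact hbd x u hx hu
    have h := MeasureTheory.hasSum_integral_iUnion (f := H x) (μ := MeasureTheory.volume)
      (s := fun j : ℕ => Set.Ico (j * x) (((j : ℝ) + 1) * x)) (fun j => measurableSet_Ico)
      (fun i j hij => Set.disjoint_left.2 fun u hi hj => hij ((hfl i u hi).symm.trans (hfl j u hj)))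
      (by rw [hU]; exact hI)
    rw [hU, MeasureTheory.integral_Ici_eq_integral_Ioi] at h
    rw [← h.tsum_eq]
    refine tsum_congr fun j => ?_
    rw [MeasureTheory.setIntegral_congr_fun (g := fun _ => G (((j : ℝ) + 1) * x)) measurableSet_Ico]
    · simp
      left; ring_nf; exact (max_eq_left hx.le).symm
    · intro u hu
      simp [hH, hfl j u hu]
  have key : Tendsto (fun x : ℝ => ∫ u in Set.Ioi (0 : ℝ), H x u) (𝓝[>] 0)
      (𝓝 (∫ u in Set.Ioi (0 : ℝ), G u)) := by
    refine MeasureTheory.tendsto_integral_filter_of_dominated_convergence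
      (fun u => C * (1 + u ^ 2)⁻¹) ?_ ?_ hint ?_
    · filter_upwards [self_mem_nhdsWithin] with x hx using hmeas x hx
    · filter_upwards [self_mem_nhdsWithin] with x hx
      filter_upwards [MeasureTheory.ae_restrict_mem measurableSet_Ioi] with u hu using hbd x u hx hu
    · filter_upwards [MeasureTheory.ae_restrict_mem measurableSet_Ioi] with u hu
      refine (hG.continuousAt (Ioi_mem_nhds hu)).tendsto.comp ?_
      have h0 : Tendsto (fun x : ℝ => u + x) (𝓝[>] 0) (𝓝 u) := by
        have : Tendsto (fun x : ℝ => u + x) (𝓝 0) (𝓝 (u + 0)) := by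
          exact (continuous_const.add continuous_id).tendsto 0
        rw [add_zero] at this
        exact this.mono_left nhdsWithin_le_nhds
      refine tendsto_of_tendsto_of_tendsto_of_le_of_le' tendsto_const_nhds h0 ?_ ?_
      · filter_upwards [self_mem_nhdsWithin] with x hx using (hpt x u hx hu).1.le
      · filter_upwards [self_mem_nhdsWithin] with x hx using (hpt x u hx hu).2
  refine key.congr' ?_
  filter_upwards [self_mem_nhdsWithin] with x hx using (hsum x hx).symm

/-! ### The function `e^{-ay} / (1 - e^{-y})` near the origin -/

/-- `(e^{-ay}/(1-e^{-y}) - 1/y - (1/2-a)e^{-y})/y`. -/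
noncomputable def geomRem (a y : ℝ) : ℝ :=
  (Real.exp (-(a * y)) / (1 - Real.exp (-y)) - 1 / y - (1 / 2 - a) * Real.exp (-y)) / y

theorem one_sub_exp_neg_pos {y : ℝ} (hy : 0 < y) : 0 < 1 - Real.exp (-y) := by
  have : Real.exp (-y) < 1 := Real.exp_lt_one_iff.2 (by linarith)
  linarith

theorem continuousOn_geomRem (a : ℝ) : ContinuousOn (geomRem a) (Set.Ioi 0) := by
  unfold geomRem
  refine ContinuousOn.div (ContinuousOn.sub (ContinuousOn.sub (ContinuousOn.div ?_ ?_ ?_)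
    (ContinuousOn.div ?_ ?_ ?_)) ?_) continuousOn_id ?_
  any_goals fun_prop
  · intro y hy; exact (one_sub_exp_neg_pos hy).ne'
  · intro y hy; exact (ne_of_gt hy)
  · intro y hy; exact (ne_of_gt hy)

/-- Near zero, `e^{-ay}/(1-e^{-y}) = 1/y + (1/2-a) + O(y)`, so the bracket in `geomRem` is `O(y)`.
Weighting the constant `1/2-a` by `e^{-y}` does not disturb this and secures decay at infinity. -/
theorem abs_geomRem_le_of_le_one {a y : ℝ} (ha : 0 < a) (hy : 0 < y) (hy1 : y ≤ 1) :
    |geomRem a y| ≤ 2 * (a ^ 2 + 1 + 4 * (1 + a)) := by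
  have hq := one_sub_exp_neg_pos hy
  have e1 : 1 - y ≤ Real.exp (-y) := Real.one_sub_le_exp_neg y
  have e2 : 1 - a * y ≤ Real.exp (-(a * y)) := Real.one_sub_le_exp_neg _
  have e3 : |Real.exp (-y) - (1 - y + y ^ 2 / 2)| ≤ y ^ 3 := by
    have h := Real.exp_bound (x := -y) (by rw [abs_neg, abs_of_pos hy]; exact hy1)
      (n := 3) (by norm_num)
    simp [Finset.sum_range_succ, Nat.factorial, abs_of_pos hy] at h
    have hy3 : 0 < y ^ 3 := by positivity
    refine le_trans (le_of_eq ?_) (h.trans ?_)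
    · rfl
    · linarith
  have e4 : Real.exp (-(a * y)) ≤ 1 - a * y + (a * y) ^ 2 := by
    have hay : 0 < a * y := by positivity
    have h := Real.add_one_le_exp (a * y)
    rw [Real.exp_neg]
    have h2 : (Real.exp (a * y))⁻¹ ≤ (a * y + 1)⁻¹ := by gcongr
    refine h2.trans ?_
    rw [inv_le_iff_one_le_mul₀ (by positivity)]
    nlinarith [pow_pos hay 3]
  obtain ⟨e5, e6⟩ := abs_le.1 e3
  have e7 : y / 2 ≤ 1 - Real.exp (-y) := by
    nlinarith [pow_pos hy 2, Real.exp_pos (-y), Real.quadratic_le_exp_of_nonneg hy.le,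
      Real.exp_neg y, Real.exp_pos y, mul_inv_cancel₀ (Real.exp_pos y).ne']
  obtain ⟨p, hp⟩ : ∃ p, p = Real.exp (-(a * y)) - (1 - a * y) := ⟨_, rfl⟩
  obtain ⟨r, hr⟩ : ∃ r, r = Real.exp (-y) - (1 - y + y ^ 2 / 2) := ⟨_, rfl⟩
  -- Over the common denominator the terms of order `y` and `y²` cancel. Each of the three remaining
  -- pieces is `O(y³)`, while the denominator is at least `y³/2`.
  have hN : geomRem a y = (y * p + r - (1 / 2 - a) * y *
      ((1 - Real.exp (-y)) * Real.exp (-y) - y)) / (y ^ 2 * (1 - Real.exp (-y))) := by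
    unfold geomRem
    rw [hp, hr]
    field_simp
    ring
  rw [hN, abs_div, abs_of_pos (by positivity : 0 < y ^ 2 * (1 - Real.exp (-y))),
    div_le_iff₀ (by positivity)]
  have f1 : |y * p| ≤ a ^ 2 * y ^ 3 := by
    rw [abs_of_nonneg (mul_nonneg hy.le (by linarith))]
    have : p ≤ a ^ 2 * y ^ 2 := by rw [hp]; nlinarith
    nlinarith
  have f2 : |r| ≤ y ^ 3 := by rw [hr]; exact e3
  have f3 : |(1 - Real.exp (-y)) * Real.exp (-y) - y| ≤ 4 * y ^ 2 := by
    have hE := Real.exp_pos (-y)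
    rw [abs_le]
    constructor
    · nlinarith [pow_pos hy 3, pow_pos hy 2,
        mul_nonneg hq.le (by linarith : 0 ≤ Real.exp (-y) - (1 - y))]
    · nlinarith [pow_pos hy 2]
  have f4 : |(1 / 2 - a) * y * ((1 - Real.exp (-y)) * Real.exp (-y) - y)| ≤
      4 * (1 + a) * y ^ 3 := by
    rw [abs_mul, abs_mul, abs_of_pos hy]
    have : |1 / 2 - a| ≤ 1 + a := by rw [abs_le]; constructor <;> linarith
    calc _ ≤ (1 + a) * y * (4 * y ^ 2) := by gcongr
      _ = _ := by ring
  calc _ ≤ |y * p| + |r| + |(1 / 2 - a) * y * ((1 - Real.exp (-y)) * Real.exp (-y) - y)| :=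
        (abs_sub _ _).trans (by gcongr; exact abs_add_le _ _)
    _ ≤ a ^ 2 * y ^ 3 + y ^ 3 + 4 * (1 + a) * y ^ 3 := by gcongr
    _ = 2 * (a ^ 2 + 1 + 4 * (1 + a)) * (y ^ 2 * (y / 2)) := by ring
    _ ≤ _ := by gcongr

theorem exists_abs_geomRem_le {a : ℝ} (ha : 0 < a) :
    ∃ C : ℝ, ∀ y, 0 < y → |geomRem a y| ≤ C * (1 + y ^ 2)⁻¹ := by
  refine ⟨2 * (2 * (a ^ 2 + 1 + 4 * (1 + a)) + (2 / a + 1 + (1 + a))), fun y hy => ?_⟩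
  rw [← div_eq_mul_inv, le_div_iff₀ (by positivity)]
  rcases le_total y 1 with h1 | h1
  · have h := abs_geomRem_le_of_le_one ha hy h1
    calc _ ≤ (2 * (a ^ 2 + 1 + 4 * (1 + a))) * 2 := by
          gcongr
          nlinarith
      _ ≤ _ := by
          have : 0 < 2 / a + 1 + (1 + a) := by positivity
          linarith
  · have hq : 1 / 2 ≤ 1 - Real.exp (-y) := by
      have h3 : Real.exp (-y) ≤ Real.exp (-1) := Real.exp_le_exp.2 (by linarith)
      have h2 := Real.exp_neg_one_lt_d9
      linarith
    have e1 : Real.exp (-(a * y)) / (1 - Real.exp (-y)) ≤ 2 / a / y := by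
      rw [div_le_iff₀ (by linarith)]
      have h := Real.add_one_le_exp (a * y)
      have hay : 0 < a * y := by positivity
      have h2 : Real.exp (-(a * y)) ≤ 1 / (a * y) := by
        rw [Real.exp_neg, ← one_div]; gcongr; linarith
      calc _ ≤ 1 / (a * y) := h2
        _ = 2 / a / y * (1 / 2) := by field_simp
        _ ≤ _ := by gcongr
    have e2 : Real.exp (-y) ≤ 1 / y := by
      have h := Real.add_one_le_exp y
      rw [Real.exp_neg, ← one_div]; gcongr; linarith
    have hb : |1 / 2 - a| ≤ 1 + a := by rw [abs_le]; constructor <;> linarith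
    have e3 : |geomRem a y| ≤ (2 / a + 1 + (1 + a)) / y / y := by
      unfold geomRem
      rw [abs_div, abs_of_pos hy]
      gcongr
      calc _ ≤ |Real.exp (-(a * y)) / (1 - Real.exp (-y))| + |1 / y| +
            |(1 / 2 - a) * Real.exp (-y)| := (abs_sub _ _).trans (by gcongr; exact abs_sub _ _)
        _ ≤ 2 / a / y + 1 / y + (1 + a) * (1 / y) := by
            rw [abs_of_nonneg (by positivity), abs_of_pos (by positivity : 0 < 1 / y), abs_mul,
              abs_of_pos (Real.exp_pos _)]
            gcongr
        _ = _ := by ring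
    calc _ ≤ (2 / a + 1 + (1 + a)) / y / y * (1 + y ^ 2) := by gcongr
      _ ≤ (2 / a + 1 + (1 + a)) / y / y * (2 * y ^ 2) := by gcongr; nlinarith
      _ = 2 * (2 / a + 1 + (1 + a)) := by field_simp
      _ ≤ _ := by
          have : 0 < 2 * (a ^ 2 + 1 + 4 * (1 + a)) := by positivity
          linarith

/-! ### Asymptotics of `∑ₖ -log (1 - e^{-x(k+a)})` -/

/-- `-log (1 - e^{-y})`. -/
noncomputable def negLogOneSubExp (y : ℝ) : ℝ := -Real.log (1 - Real.exp (-y))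

/-- `∑ₖ -log (1 - e^{-x(k+a)})`. -/
noncomputable def logQPoch (a x : ℝ) : ℝ := ∑' k : ℕ, negLogOneSubExp (x * (k + a))

theorem hasSum_negLogOneSubExp {y : ℝ} (hy : 0 < y) :
    HasSum (fun j : ℕ => Real.exp (-((j + 1) * y)) / (j + 1)) (negLogOneSubExp y) := by
  have h := Real.hasSum_pow_div_log_of_abs_lt_one (x := Real.exp (-y))
    (by rw [abs_of_pos (Real.exp_pos _)]; exact Real.exp_lt_one_iff.2 (by linarith))
  refine h.congr_fun ?_
  intro j
  rw [← Real.exp_nat_mul]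
  congr 2
  push_cast; ring

theorem exp_negLogOneSubExp {y : ℝ} (hy : 0 < y) :
    Real.exp (negLogOneSubExp y) = (1 - Real.exp (-y))⁻¹ := by
  rw [negLogOneSubExp, Real.exp_neg, Real.exp_log (one_sub_exp_neg_pos hy)]

/-- The function is the sum of `e^{-jy}/j` over `j ≥ 1`, a positive combination of convex
exponentials. This is the source of the convexity needed for Bohr-Mollerup. -/
theorem convexOn_negLogOneSubExp : ConvexOn ℝ (Set.Ioi 0) negLogOneSubExp := by
  refine ⟨convex_Ioi 0, fun u hu v hv p q hp hq hpq => ?_⟩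
  have hw : 0 < p • u + q • v := (convex_Ioi (0 : ℝ)) hu hv hp hq hpq
  refine hasSum_le (fun j => ?_) (hasSum_negLogOneSubExp hw)
    (((hasSum_negLogOneSubExp hu).mul_left p).add ((hasSum_negLogOneSubExp hv).mul_left q))
  have h := convexOn_exp.2 (Set.mem_univ (-((j + 1) * u))) (Set.mem_univ (-((j + 1) * v))) hp hq hpq
  simp only [smul_eq_mul] at h ⊢
  rw [← mul_div_assoc, ← mul_div_assoc, ← add_div]
  gcongr
  refine le_trans (le_of_eq ?_) h
  congr 1; ring

theorem tendsto_negLogOneSubExp_add_log :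
    Tendsto (fun x => negLogOneSubExp x + Real.log x) (𝓝[>] 0) (𝓝 0) := by
  have h1 : HasDerivAt (fun x : ℝ => 1 - Real.exp (-x)) 1 0 := by
    have := ((hasDerivAt_neg (0 : ℝ)).exp).const_sub 1
    simpa using this
  have h2 : Tendsto (fun x : ℝ => (1 - Real.exp (-x)) / x) (𝓝[>] 0) (𝓝 1) := by
    have := h1.tendsto_slope_zero_right
    simpa [div_eq_inv_mul] using this
  have h3 := ((Real.continuousAt_log one_ne_zero).tendsto.comp h2).neg
  rw [Real.log_one, neg_zero] at h3
  refine h3.congr' ?_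
  filter_upwards [self_mem_nhdsWithin] with x hx
  simp only [Function.comp, negLogOneSubExp]
  rw [Real.log_div (one_sub_exp_neg_pos hx).ne' (ne_of_gt hx)]
  ring

theorem summable_exp_geom {a x : ℝ} (ha : 0 < a) (hx : 0 < x) :
    Summable (fun j : ℕ => Real.exp (-(a * ((j + 1) * x))) / (1 - Real.exp (-((j + 1) * x))) /
      ((j : ℝ) + 1)) := by
  have h0 := one_sub_exp_neg_pos hx
  have hgeo : Summable (fun j : ℕ => Real.exp (-(a * x)) ^ j * (1 - Real.exp (-x))⁻¹) :=
    (summable_geometric_of_lt_one (Real.exp_pos _).le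
      (Real.exp_lt_one_iff.2 (by nlinarith [mul_pos ha hx]))).mul_right _
  refine hgeo.of_nonneg_of_le (fun j => ?_) fun j => ?_
  · have := one_sub_exp_neg_pos (y := ((j : ℝ) + 1) * x) (by positivity)
    positivity
  · have h1 : (1 : ℝ) - Real.exp (-x) ≤ 1 - Real.exp (-((j + 1) * x)) := by
      gcongr
      nlinarith [mul_nonneg (Nat.cast_nonneg (α := ℝ) j) hx.le]
    have h2 : Real.exp (-(a * ((j + 1) * x))) ≤ Real.exp (-(a * x)) ^ j := by
      rw [← Real.exp_nat_mul]
      gcongr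
      nlinarith [mul_pos ha hx]
    calc _ ≤ Real.exp (-(a * ((j + 1) * x))) / (1 - Real.exp (-((j + 1) * x))) :=
          div_le_self (div_nonneg (Real.exp_pos _).le (h0.le.trans h1))
            (by linarith [Nat.cast_nonneg (α := ℝ) j])
      _ ≤ Real.exp (-(a * x)) ^ j / (1 - Real.exp (-x)) := by gcongr
      _ = _ := by rw [div_eq_mul_inv]

theorem hasSum_geom_exp {a x : ℝ} (hx : 0 < x) (j : ℕ) :
    HasSum (fun k : ℕ => Real.exp (-((j + 1) * (x * (k + a)))) / ((j : ℝ) + 1))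
      (Real.exp (-(a * ((j + 1) * x))) / (1 - Real.exp (-((j + 1) * x))) / ((j : ℝ) + 1)) := by
  have h := (hasSum_geometric_of_lt_one (Real.exp_pos (-(((j : ℝ) + 1) * x))).le
    (Real.exp_lt_one_iff.2 (by have : 0 < ((j : ℝ) + 1) * x := by positivity
                               linarith))).mul_left (Real.exp (-(a * ((j + 1) * x))))
  refine (h.div_const ((j : ℝ) + 1)).congr_fun ?_
  intro k
  rw [← Real.exp_nat_mul, ← Real.exp_add]
  congr 2; ring

theorem summable_logQPoch_double {a x : ℝ} (ha : 0 < a) (hx : 0 < x) :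
    Summable (fun p : ℕ × ℕ =>
      Real.exp (-((p.1 + 1) * (x * (p.2 + a)))) / ((p.1 : ℝ) + 1)) := by
  refine (summable_prod_of_nonneg (fun p => by positivity)).2 ⟨fun j => ?_, ?_⟩
  · exact (hasSum_geom_exp hx j).summable
  · exact (summable_exp_geom ha hx).congr fun j => ((hasSum_geom_exp hx j).tsum_eq).symm

theorem summable_negLogOneSubExp {a x : ℝ} (ha : 0 < a) (hx : 0 < x) :
    Summable (fun k : ℕ => negLogOneSubExp (x * (k + a))) := by
  refine ((summable_logQPoch_double ha hx).prod_symm.prod).congr fun k => ?_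
  exact (hasSum_negLogOneSubExp (y := x * (k + a)) (by positivity)).tsum_eq

/-- Expand each logarithm and sum over `k` first: the inner series is geometric, and the interchange
is allowed since all terms are positive. -/
theorem logQPoch_eq_tsum {a x : ℝ} (ha : 0 < a) (hx : 0 < x) :
    logQPoch a x = ∑' j : ℕ, Real.exp (-(a * ((j + 1) * x))) /
      (1 - Real.exp (-((j + 1) * x))) / ((j : ℝ) + 1) := by
  have h := Summable.tsum_comm
    (f := fun j k : ℕ => Real.exp (-((j + 1) * (x * (k + a)))) / ((j : ℝ) + 1))
    (summable_logQPoch_double ha hx)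
  rw [logQPoch]
  rw [tsum_congr fun k : ℕ => ((hasSum_negLogOneSubExp (y := x * (k + a))
    (by positivity)).tsum_eq).symm, h]
  exact tsum_congr fun j => (hasSum_geom_exp hx j).tsum_eq

/-- The two counterterms in `geomRem` sum in closed form: `1/y` produces `ζ(2)/x`, and `e^{-y}`
produces the series of `-log(1-e^{-x})`. -/
theorem logQPoch_sub_eq {a x : ℝ} (ha : 0 < a) (hx : 0 < x) :
    ∑' j : ℕ, x * geomRem a (((j : ℝ) + 1) * x) =
      logQPoch a x - π ^ 2 / 6 / x - (1 / 2 - a) * negLogOneSubExp x := by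
  have hz : HasSum (fun j : ℕ => 1 / ((j : ℝ) + 1) ^ 2 / x) (π ^ 2 / 6 / x) := by
    have := (hasSum_nat_add_iff' 1).2 hasSum_zeta_two
    simp at this
    simpa using this.div_const x
  have h := (((summable_exp_geom ha hx).hasSum.sub hz).sub
    ((hasSum_negLogOneSubExp hx).mul_left (1 / 2 - a)))
  rw [logQPoch_eq_tsum ha hx, ← h.tsum_eq]
  refine tsum_congr fun j => ?_
  unfold geomRem
  have := one_sub_exp_neg_pos (y := ((j : ℝ) + 1) * x) (by positivity)
  have hj : (j : ℝ) + 1 ≠ 0 := by positivity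
  field_simp

/-- The constant term of `logQPoch a` at the origin. -/
noncomputable def logQPochConst (a : ℝ) : ℝ := ∫ u in Set.Ioi (0 : ℝ), geomRem a u

theorem tendsto_logQPoch_const {a : ℝ} (ha : 0 < a) :
    Tendsto (fun x => logQPoch a x - (π ^ 2 / 6 / x - (1 / 2 - a) * Real.log x)) (𝓝[>] 0)
      (𝓝 (logQPochConst a)) := by
  obtain ⟨C, hC⟩ := exists_abs_geomRem_le ha
  have h := (tendsto_tsum_mul_nhdsGT_zero (continuousOn_geomRem a) hC).add
    (tendsto_negLogOneSubExp_add_log.const_mul (1 / 2 - a))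
  rw [mul_zero, add_zero] at h
  refine h.congr' ?_
  filter_upwards [self_mem_nhdsWithin] with x hx
  rw [logQPoch_sub_eq ha hx]
  ring

theorem tendsto_const_mul_nhdsGT_zero {s : ℝ} (hs : 0 < s) :
    Tendsto (fun x : ℝ => s * x) (𝓝[>] 0) (𝓝[>] 0) := by
  refine tendsto_nhdsWithin_iff.2 ⟨?_, ?_⟩
  · have : Tendsto (fun x : ℝ => s * x) (𝓝 0) (𝓝 (s * 0)) := tendsto_id.const_mul s
    rw [mul_zero] at this
    exact this.mono_left nhdsWithin_le_nhds
  · filter_upwards [self_mem_nhdsWithin] with x hx using mul_pos hs hx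

/-- Splitting off the term `k = 0` of `logQPoch a` leaves `logQPoch (a+1)`, and that term is
`-log(ax) + o(1)`. -/
theorem logQPochConst_add_one {a : ℝ} (ha : 0 < a) :
    logQPochConst (a + 1) = logQPochConst a + Real.log a := by
  have h1 := (tendsto_logQPoch_const ha).sub (tendsto_logQPoch_const (a := a + 1) (by linarith))
  have h2 := (tendsto_negLogOneSubExp_add_log.comp (tendsto_const_mul_nhdsGT_zero ha)).sub_const
    (Real.log a)
  have := tendsto_nhds_unique (h1.congr' ?_) h2
  · linarith
  filter_upwards [self_mem_nhdsWithin] with x (hx : 0 < x)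
  have h3 : logQPoch a x = negLogOneSubExp (a * x) + logQPoch (a + 1) x := by
    rw [logQPoch, (summable_negLogOneSubExp ha hx).tsum_eq_zero_add, logQPoch]
    congr 1
    · congr 1; push_cast; ring
    · refine tsum_congr fun k => ?_
      congr 1; push_cast; ring
  simp only [Function.comp]
  rw [h3, Real.log_mul ha.ne' hx.ne']
  ring

/-- For fixed `x`, `logQPoch` is convex in `a` and the subtracted main term is affine in `a`;
convexity survives the limit. -/
theorem convexOn_logQPochConst : ConvexOn ℝ (Set.Ioi 0) logQPochConst := by
  refine ⟨convex_Ioi 0, fun u hu v hv p q hp hq hpq => ?_⟩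
  have hw : 0 < p • u + q • v := (convex_Ioi (0 : ℝ)) hu hv hp hq hpq
  refine le_of_tendsto_of_tendsto (tendsto_logQPoch_const hw)
    (((tendsto_logQPoch_const hu).const_mul p).add ((tendsto_logQPoch_const hv).const_mul q)) ?_
  filter_upwards [self_mem_nhdsWithin] with x (hx : 0 < x)
  have h : logQPoch (p • u + q • v) x ≤ p * logQPoch u x + q * logQPoch v x := by
    refine hasSum_le (fun k => ?_) (summable_negLogOneSubExp hw hx).hasSum
      (((summable_negLogOneSubExp hu hx).hasSum.mul_left p).add
        ((summable_negLogOneSubExp hv hx).hasSum.mul_left q))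
    have hu' : 0 < u := hu
    have hv' : 0 < v := hv
    have := convexOn_negLogOneSubExp.2 (x := x * (k + u)) (y := x * (k + v))
      (by simp only [Set.mem_Ioi]; positivity) (by simp only [Set.mem_Ioi]; positivity) hp hq hpq
    simp only [smul_eq_mul] at this ⊢
    refine le_trans (le_of_eq ?_) this
    congr 1
    linear_combination x * k * (-hpq)
  simp only [smul_eq_mul] at h ⊢
  linear_combination h + (-π ^ 2 / 6 / x + 1 / 2 * Real.log x) * (-hpq)

/-- Convexity and the functional equation make the Bohr-Mollerup sequence converge to the left side;
it also converges to `log Γ`. -/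
theorem logQPochConst_sub_one {a : ℝ} (ha : 0 < a) :
    logQPochConst a - logQPochConst 1 = Real.log (Real.Gamma a) :=
  tendsto_nhds_unique
    (Real.BohrMollerup.tendsto_logGammaSeq convexOn_logQPochConst
      (fun hy => logQPochConst_add_one hy) ha)
    (Real.BohrMollerup.tendsto_log_gamma ha)

/-- Separating even and odd indices gives `logQPoch (1/2) (2x) + logQPoch 1 (2x) = logQPoch 1 x`.
The unknown constant at `1` cancels, so this determines the one at `1/2`. -/
theorem logQPochConst_half : logQPochConst (1 / 2) = -(Real.log 2 / 2) := by
  have h0 : (0 : ℝ) < 1 / 2 := by norm_num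
  have h1 := (tendsto_logQPoch_const h0).comp (tendsto_const_mul_nhdsGT_zero two_pos)
  have h2 := (tendsto_logQPoch_const one_pos).comp (tendsto_const_mul_nhdsGT_zero two_pos)
  have h3 := tendsto_logQPoch_const one_pos
  have h4 : Tendsto (fun _ : ℝ => -(Real.log 2 / 2)) (𝓝[>] (0 : ℝ)) (𝓝 (-(Real.log 2 / 2))) :=
    tendsto_const_nhds
  have := tendsto_nhds_unique (((h1.add h2).sub h3).congr' ?_) h4
  · linarith
  filter_upwards [self_mem_nhdsWithin] with x (hx : 0 < x)
  have h5 : logQPoch (1 / 2) (2 * x) + logQPoch 1 (2 * x) = logQPoch 1 x := by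
    have e1 (k : ℕ) : negLogOneSubExp (2 * x * (k + 1 / 2)) =
        negLogOneSubExp (x * ((2 * k : ℕ) + 1)) := by congr 1; push_cast; ring
    have e2 (k : ℕ) : negLogOneSubExp (2 * x * (k + 1)) =
        negLogOneSubExp (x * ((2 * k + 1 : ℕ) + 1)) := by congr 1; push_cast; ring
    obtain ⟨f, hf⟩ : ∃ f : ℕ → ℝ, f = fun k : ℕ => negLogOneSubExp (x * (k + 1)) := ⟨_, rfl⟩
    have hs : Summable f := hf ▸ summable_negLogOneSubExp one_pos hx
    have hev : Summable fun k => f (2 * k) :=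
      hs.comp_injective (i := fun k => 2 * k) fun a b h => by simpa using h
    have hod : Summable fun k => f (2 * k + 1) :=
      hs.comp_injective (i := fun k => 2 * k + 1) fun a b h => by simpa using h
    have := tsum_even_add_odd hev hod
    rw [hf] at this
    rw [logQPoch, logQPoch, logQPoch, tsum_congr e1, tsum_congr e2]
    exact this
  simp only [Function.comp]
  rw [← h5, Real.log_mul two_ne_zero hx.ne']
  field_simp
  ring

/-- The value at `1/2`, with `Γ(1/2) = √π`, forces the constant at `1` to be `-log(2π)/2`. -/
theorem tendsto_logQPoch {a : ℝ} (ha : 0 < a) :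
    Tendsto (fun x => logQPoch a x - (π ^ 2 / 6 / x - (1 / 2 - a) * Real.log x)) (𝓝[>] 0)
      (𝓝 (Real.log (Real.Gamma a) - Real.log (2 * π) / 2)) := by
  have h1 := logQPochConst_sub_one ha
  have h2 := logQPochConst_sub_one (a := 1 / 2) (by norm_num)
  rw [logQPochConst_half, Real.Gamma_one_half_eq, Real.log_sqrt pi_pos.le] at h2
  have h3 : logQPochConst a = Real.log (Real.Gamma a) - Real.log (2 * π) / 2 := by
    rw [Real.log_mul two_ne_zero pi_ne_zero]
    linarith
  exact h3 ▸ tendsto_logQPoch_const ha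

/-! ### From moment generating functions to characteristic functions -/

/-- Strong induction on `k`: once the lower coefficients tend to zero, evaluation at a small `u`
isolates the `k`-th term up to a tail that the Cauchy-type bound controls. -/
theorem tendsto_zero_coeff_of_tendsto_tsum {α : Type*} {l : Filter α} {e : α → ℕ → ℂ} {K R : ℝ}
    (hR : 0 < R) (hb : ∀ᶠ n in l, ∀ k, ‖e n k‖ * R ^ k ≤ K)
    (h : ∀ u : ℝ, 0 < u → u < R → Tendsto (fun n => ∑' k, e n k * (u : ℂ) ^ k) l (𝓝 0)) (k : ℕ) :
    Tendsto (fun n => e n k) l (𝓝 0) := by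
  induction k using Nat.strong_induction_on with
  | _ k ih =>
  rcases l.eq_or_neBot with rfl | hl
  · exact tendsto_bot
  have hK : 0 ≤ K := by
    obtain ⟨n, hn⟩ := hb.exists
    exact le_trans (by positivity) (hn 0)
  rw [Metric.tendsto_nhds]
  intro ε hε
  -- At `u = Rδ` the tail beyond `k` is at most `2Kδ^(k+1)`, the `2` coming from `δ ≤ 1/2`. The last
  -- condition makes it less than `(ε/2) u^k`.
  obtain ⟨δ, hδ0, hδ1, hδ⟩ : ∃ δ : ℝ, 0 < δ ∧ δ ≤ 1 / 2 ∧ 2 * K * δ < ε / 2 * R ^ k := by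
    have hpos : 0 < ε / 2 * R ^ k / (2 * K + 1) := by positivity
    refine ⟨min (1 / 2) (ε / 2 * R ^ k / (2 * K + 1)), lt_min (by norm_num) hpos,
      min_le_left _ _, ?_⟩
    calc 2 * K * min (1 / 2) (ε / 2 * R ^ k / (2 * K + 1))
        ≤ 2 * K * (ε / 2 * R ^ k / (2 * K + 1)) := by gcongr; exact min_le_right _ _
      _ < (2 * K + 1) * (ε / 2 * R ^ k / (2 * K + 1)) := by gcongr; linarith
      _ = _ := by field_simp
  set u : ℝ := R * δ with hu
  have hu0 : 0 < u := by positivity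
  have huR : u < R := by nlinarith
  have hlim : Tendsto (fun n => ‖∑' k, e n k * (u : ℂ) ^ k‖ +
      ∑ j ∈ Finset.range k, ‖e n j‖ * u ^ j) l
      (𝓝 (‖(0 : ℂ)‖ + ∑ j ∈ Finset.range k, ‖(0 : ℂ)‖ * u ^ j)) := by
    refine (h u hu0 huR).norm.add (tendsto_finsetSum _ fun j hj => ?_)
    exact ((ih j (Finset.mem_range.1 hj)).norm).mul_const _
  simp only [norm_zero, zero_mul, Finset.sum_const_zero, add_zero] at hlim
  filter_upwards [hb, hlim.eventually_lt_const (show 0 < ε / 2 * u ^ k by positivity)] with n hn hlt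
  rw [dist_zero_right]
  have hterm (j : ℕ) : ‖e n j * (u : ℂ) ^ j‖ ≤ K * δ ^ j := by
    rw [norm_mul, norm_pow, Complex.norm_real, Real.norm_of_nonneg hu0.le, hu, mul_pow,
      ← mul_assoc]
    gcongr
    exact hn j
  have hgeo : Summable fun j : ℕ => K * δ ^ j :=
    (summable_geometric_of_lt_one hδ0.le (by linarith)).mul_left K
  have hsum : Summable fun j => e n j * (u : ℂ) ^ j := hgeo.of_norm_bounded hterm
  have hsplit := hsum.sum_add_tsum_nat_add (k + 1)
  rw [Finset.sum_range_succ] at hsplit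
  have htail : ‖∑' i, e n (i + (k + 1)) * (u : ℂ) ^ (i + (k + 1))‖ ≤ 2 * K * δ ^ (k + 1) := by
    have hg : HasSum (fun i : ℕ => K * δ ^ (i + (k + 1))) (K * δ ^ (k + 1) * (1 - δ)⁻¹) := by
      refine ((hasSum_geometric_of_lt_one hδ0.le (by linarith)).mul_left
        (K * δ ^ (k + 1))).congr_fun fun i => ?_
      ring
    refine (tsum_of_norm_bounded hg fun i => hterm _).trans ?_
    have : (1 - δ)⁻¹ ≤ 2 := by
      rw [inv_le_comm₀ (by linarith) two_pos]; linarith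
    calc _ ≤ K * δ ^ (k + 1) * 2 := by gcongr
      _ = _ := by ring
  have hfin : ‖∑ j ∈ Finset.range k, e n j * (u : ℂ) ^ j‖ ≤
      ∑ j ∈ Finset.range k, ‖e n j‖ * u ^ j := by
    refine (norm_sum_le _ _).trans (le_of_eq (Finset.sum_congr rfl fun j _ => ?_))
    rw [norm_mul, norm_pow, Complex.norm_real, Real.norm_of_nonneg hu0.le]
  have hk : ‖e n k‖ * u ^ k ≤ ‖∑' k, e n k * (u : ℂ) ^ k‖ +
      ∑ j ∈ Finset.range k, ‖e n j‖ * u ^ j + 2 * K * δ ^ (k + 1) := by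
    have heq : e n k * (u : ℂ) ^ k = ∑' k, e n k * (u : ℂ) ^ k -
        ∑ j ∈ Finset.range k, e n j * (u : ℂ) ^ j -
        ∑' i, e n (i + (k + 1)) * (u : ℂ) ^ (i + (k + 1)) := by
      rw [← hsplit]; ring
    calc ‖e n k‖ * u ^ k = ‖e n k * (u : ℂ) ^ k‖ := by
          rw [norm_mul, norm_pow, Complex.norm_real, Real.norm_of_nonneg hu0.le]
      _ ≤ _ := by
          rw [heq]
          refine (norm_sub_le _ _).trans (add_le_add ((norm_sub_le _ _).trans ?_) htail)
          gcongr
  have hlast : 2 * K * δ ^ (k + 1) < ε / 2 * u ^ k := by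
    rw [hu, mul_pow, pow_succ]
    calc 2 * K * (δ ^ k * δ) = 2 * K * δ * δ ^ k := by ring
      _ < ε / 2 * R ^ k * δ ^ k := by gcongr
      _ = _ := by ring
  have : ‖e n k‖ * u ^ k < ε * u ^ k := by linarith
  exact lt_of_mul_lt_mul_right this (by positivity)

/-- A Vitali-type principle: bounded power series that tend to zero on a real segment do so
throughout the disc, by convergence of coefficients and domination by a geometric series. -/
theorem tendsto_zero_tsum_of_tendsto_real {α : Type*} {l : Filter α} {e : α → ℕ → ℂ} {K R : ℝ}
    (hR : 0 < R) (hb : ∀ᶠ n in l, ∀ k, ‖e n k‖ * R ^ k ≤ K)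
    (h : ∀ u : ℝ, 0 < u → u < R → Tendsto (fun n => ∑' k, e n k * (u : ℂ) ^ k) l (𝓝 0))
    {w : ℂ} (hw : ‖w‖ < R) : Tendsto (fun n => ∑' k, e n k * w ^ k) l (𝓝 0) := by
  have hr : ‖w‖ / R < 1 := (div_lt_one hR).2 hw
  have := tendsto_tsum_of_dominated_convergence (𝓕 := l) (f := fun n k => e n k * w ^ k)
    (g := fun _ => 0) (bound := fun k => K * (‖w‖ / R) ^ k)
    ((summable_geometric_of_lt_one (by positivity) hr).mul_left K) (fun k => by
      simpa using (tendsto_zero_coeff_of_tendsto_tsum hR hb h k).mul_const (w ^ k)) (by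
      filter_upwards [hb] with n hn k
      rw [norm_mul, norm_pow, div_pow, ← mul_div_assoc, le_div_iff₀ (by positivity)]
      calc _ = ‖e n k‖ * R ^ k * ‖w‖ ^ k := by ring
        _ ≤ _ := by gcongr; exact hn k)
  simpa using this

/-- Since `e^(R|y|) ≤ e^(Ry) + e^(-Ry)`, the two real values at `±R` control all absolute moments.
This justifies expanding the exponential and also bounds the coefficients. -/
theorem exists_power_series_tsum_exp {p y : ℕ → ℝ} {R : ℝ} (hR : 0 < R) (hp : ∀ m, 0 ≤ p m)
    (h1 : Summable fun m => p m * Real.exp (R * y m))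
    (h2 : Summable fun m => p m * Real.exp (-R * y m)) :
    ∃ c : ℕ → ℂ, (∀ k, ‖c k‖ * R ^ k ≤
        ∑' m, p m * Real.exp (R * y m) + ∑' m, p m * Real.exp (-R * y m)) ∧
      ∀ w : ℂ, ‖w‖ ≤ R →
        HasSum (fun k => c k * w ^ k) (∑' m, (p m : ℂ) * Complex.exp (w * y m)) := by
  have habs (m : ℕ) : p m * Real.exp (R * |y m|) ≤
      p m * Real.exp (R * y m) + p m * Real.exp (-R * y m) := by
    rw [← mul_add]
    refine mul_le_mul_of_nonneg_left ?_ (hp m)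
    rcases abs_cases (y m) with ⟨h, _⟩ | ⟨h, _⟩ <;> rw [h]
    · linarith [Real.exp_pos (-R * y m)]
    · rw [show R * -y m = -R * y m by ring]
      linarith [Real.exp_pos (R * y m)]
  have h3 : Summable fun m => p m * Real.exp (R * |y m|) :=
    (h1.add h2).of_nonneg_of_le (fun m => mul_nonneg (hp m) (Real.exp_pos _).le) habs
  have hexp (m : ℕ) : HasSum (fun k : ℕ => p m * ((R * |y m|) ^ k / (k.factorial : ℝ)))
      (p m * Real.exp (R * |y m|)) := by
    have := NormedSpace.expSeries_div_hasSum_exp (R * |y m|)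
    rw [← Real.exp_eq_exp_ℝ] at this
    exact this.mul_left _
  have hdbl : Summable fun q : ℕ × ℕ =>
      p q.1 * ((R * |y q.1|) ^ q.2 / (q.2.factorial : ℝ)) := by
    refine (summable_prod_of_nonneg fun q => ?_).2 ⟨fun m => (hexp m).summable, ?_⟩
    · have := hp q.1; simp only [Pi.zero_apply]; positivity
    · exact h3.congr fun m => ((hexp m).tsum_eq).symm
  have hcol (k : ℕ) : Summable fun m => p m * ((R * |y m|) ^ k / (k.factorial : ℝ)) :=
    hdbl.prod_symm.prod_factor k
  refine ⟨fun k => ∑' m, (p m : ℂ) * ((y m : ℂ) ^ k / (k.factorial : ℂ)), fun k => ?_,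
    fun w hw => ?_⟩
  · rw [← Real.norm_of_nonneg (pow_nonneg hR.le k), ← Complex.norm_real, ← norm_mul,
      ← tsum_mul_right]
    have hle : ‖∑' m, (p m : ℂ) * ((y m : ℂ) ^ k / (k.factorial : ℂ)) * ((R ^ k : ℝ) : ℂ)‖ ≤
        ∑' m, p m * ((R * |y m|) ^ k / (k.factorial : ℝ)) := by
      refine tsum_of_norm_bounded (hcol k).hasSum fun m => le_of_eq ?_
      simp only [norm_mul, norm_div, norm_pow, Complex.norm_real, Complex.norm_natCast,
        Real.norm_eq_abs, abs_of_nonneg (hp m), abs_of_pos hR, mul_pow, Complex.ofReal_pow]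
      ring
    refine hle.trans ?_
    rw [← h1.tsum_add h2]
    refine (hcol k).tsum_le_tsum (fun m => ?_) (h1.add h2)
    refine le_trans ?_ (habs m)
    exact le_hasSum (hexp m) k fun j _ => by have := hp m; positivity
  · have hd : Summable fun q : ℕ × ℕ =>
        (p q.1 : ℂ) * ((w * y q.1) ^ q.2 / (q.2.factorial : ℂ)) := by
      refine hdbl.of_norm_bounded fun q => ?_
      simp only [norm_mul, norm_div, norm_pow, Complex.norm_real, Complex.norm_natCast,
        Real.norm_eq_abs, abs_of_nonneg (hp q.1)]
      have := hp q.1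
      gcongr
    have hrow (m : ℕ) : HasSum (fun k : ℕ => (p m : ℂ) * ((w * y m) ^ k / (k.factorial : ℂ)))
        ((p m : ℂ) * Complex.exp (w * y m)) := by
      have := NormedSpace.expSeries_div_hasSum_exp (w * y m)
      rw [← Complex.exp_eq_exp_ℂ] at this
      exact this.mul_left _
    have hc := Summable.tsum_comm
      (f := fun m k : ℕ => (p m : ℂ) * ((w * y m) ^ k / (k.factorial : ℂ))) hd
    have hs := hd.prod_symm.prod
    have hfin : HasSum (fun k : ℕ => ∑' m, (p m : ℂ) * ((w * y m) ^ k / (k.factorial : ℂ)))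
        (∑' m, (p m : ℂ) * Complex.exp (w * y m)) := by
      rw [← tsum_congr fun m => (hrow m).tsum_eq, ← hc]
      exact hs.hasSum
    refine hfin.congr_fun fun k => ?_
    rw [← tsum_mul_right]
    refine tsum_congr fun m => ?_
    rw [mul_pow]; ring

theorem exists_power_series_exp_sq {B : ℝ} (hB : 0 ≤ B) :
    ∃ d : ℕ → ℂ, (∀ R : ℝ, 0 ≤ R → ∀ k, ‖d k‖ * R ^ k ≤ Real.exp (B * R ^ 2)) ∧
      ∀ w : ℂ, HasSum (fun k => d k * w ^ k) (Complex.exp (B * w ^ 2)) := by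
  have hinj : Function.Injective fun k : ℕ => 2 * k := fun a b h => by simpa using h
  have hout (k : ℕ) (hk : k ∉ Set.range fun k : ℕ => 2 * k) : ¬Even k := by
    rintro ⟨r, hr⟩
    exact hk ⟨r, by simp only; omega⟩
  have hsum (w : ℂ) : HasSum (fun k : ℕ => (if Even k then (B : ℂ) ^ (k / 2) /
      ((k / 2).factorial : ℂ) else 0) * w ^ k) (Complex.exp (B * w ^ 2)) := by
    rw [← hinj.hasSum_iff]
    · have := NormedSpace.expSeries_div_hasSum_exp ((B : ℂ) * w ^ 2)
      rw [← Complex.exp_eq_exp_ℂ] at this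
      refine this.congr_fun fun k => ?_
      simp only [Function.comp, even_two_mul, if_true,
        Nat.mul_div_cancel_left k two_pos, pow_mul, mul_pow]
      ring
    · intro k hk
      rw [if_neg (hout k hk), zero_mul]
  refine ⟨_, fun R hR k => ?_, hsum⟩
  have hre : HasSum (fun k : ℕ => (if Even k then B ^ (k / 2) / ((k / 2).factorial : ℝ) else 0) *
      R ^ k) (Real.exp (B * R ^ 2)) := by
    rw [← Complex.hasSum_ofReal]
    push_cast
    refine (hsum R).congr_fun fun k => ?_
    split_ifs <;> simp
  refine le_trans (le_of_eq ?_) (le_hasSum hre k fun j _ => ?_)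
  · split_ifs <;> simp [abs_of_nonneg hB]
  · split_ifs <;> positivity

/-- Convergence of moment generating functions on the real line is extended to the complex plane;
imaginary `w` gives characteristic functions. The values at `±R` are eventually bounded, so the
Vitali-type principle applies to the difference from `e^(Bw²)`. -/
theorem tendsto_tsum_cexp_of_tendsto_tsum_exp {α : Type*} {l : Filter α} {p y : α → ℕ → ℝ} {B : ℝ}
    (hB : 0 ≤ B) (hp : ∀ n m, 0 ≤ p n m)
    (hs : ∀ u : ℝ, ∀ᶠ n in l, Summable fun m => p n m * Real.exp (u * y n m))
    (h : ∀ u : ℝ, Tendsto (fun n => ∑' m, p n m * Real.exp (u * y n m)) l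
      (𝓝 (Real.exp (B * u ^ 2)))) (w : ℂ) :
    Tendsto (fun n => ∑' m, (p n m : ℂ) * Complex.exp (w * y n m)) l
      (𝓝 (Complex.exp (B * w ^ 2))) := by
  obtain ⟨R, hR, hwR⟩ : ∃ R : ℝ, 0 < R ∧ ‖w‖ < R := ⟨‖w‖ + 1, by positivity, by linarith⟩
  obtain ⟨d, hd, hdw⟩ := exists_power_series_exp_sq hB
  -- Summability holds only eventually along `l`, so the expansion is made conditional on it, with
  -- the zero sequence as default elsewhere.
  have hc : ∀ n, ∃ c : ℕ → ℂ, (Summable fun m => p n m * Real.exp (R * y n m)) →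
      (Summable fun m => p n m * Real.exp (-R * y n m)) → (∀ k, ‖c k‖ * R ^ k ≤
        ∑' m, p n m * Real.exp (R * y n m) + ∑' m, p n m * Real.exp (-R * y n m)) ∧
      ∀ w : ℂ, ‖w‖ ≤ R →
        HasSum (fun k => c k * w ^ k) (∑' m, (p n m : ℂ) * Complex.exp (w * y n m)) := by
    intro n
    by_cases h1 : Summable fun m => p n m * Real.exp (R * y n m)
    · by_cases h2 : Summable fun m => p n m * Real.exp (-R * y n m)
      · obtain ⟨c, hc⟩ := exists_power_series_tsum_exp hR (hp n) h1 h2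
        exact ⟨c, fun _ _ => hc⟩
      · exact ⟨0, fun _ h => (h2 h).elim⟩
    · exact ⟨0, fun h => (h1 h).elim⟩
  choose c hc using hc
  have hev : ∀ᶠ n in l, (∀ k, ‖c n k‖ * R ^ k ≤
        ∑' m, p n m * Real.exp (R * y n m) + ∑' m, p n m * Real.exp (-R * y n m)) ∧
      ∀ w : ℂ, ‖w‖ ≤ R →
        HasSum (fun k => c n k * w ^ k) (∑' m, (p n m : ℂ) * Complex.exp (w * y n m)) := by
    filter_upwards [hs R, hs (-R)] with n h1 h2 using hc n h1 h2
  set K := 2 * (Real.exp (B * R ^ 2) + 1) with hK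
  have hM : ∀ᶠ n in l, ∑' m, p n m * Real.exp (R * y n m) +
      ∑' m, p n m * Real.exp (-R * y n m) ≤ K := by
    have h1 := (h R).eventually_lt_const (lt_add_one _)
    have h2 := (h (-R)).eventually_lt_const (lt_add_one _)
    filter_upwards [h1, h2] with n h1 h2
    rw [neg_sq] at h2
    rw [hK]; linarith
  have hb : ∀ᶠ n in l, ∀ k, ‖c n k - d k‖ * R ^ k ≤ K + Real.exp (B * R ^ 2) := by
    filter_upwards [hev, hM] with n hn hM k
    calc _ ≤ (‖c n k‖ + ‖d k‖) * R ^ k := by gcongr; exact norm_sub_le _ _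
      _ = ‖c n k‖ * R ^ k + ‖d k‖ * R ^ k := add_mul _ _ _
      _ ≤ _ := add_le_add ((hn.1 k).trans hM) (hd R hR.le k)
  have hdiff (z : ℂ) (hz : ‖z‖ ≤ R) : (fun n => ∑' k, (c n k - d k) * z ^ k) =ᶠ[l]
      fun n => ∑' m, (p n m : ℂ) * Complex.exp (z * y n m) - Complex.exp (B * z ^ 2) := by
    filter_upwards [hev] with n hn
    rw [← ((hn.2 z hz).sub (hdw z)).tsum_eq]
    exact tsum_congr fun k => sub_mul _ _ _
  have hz := tendsto_zero_tsum_of_tendsto_real (e := fun n k => c n k - d k) hR hb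
    (fun u hu huR => by
    refine Tendsto.congr' (hdiff u ?_).symm ?_
    · rw [Complex.norm_real, Real.norm_of_nonneg hu.le]; exact huR.le
    · have h1 := (Complex.continuous_ofReal.tendsto _).comp (h u)
      have h2 := h1.sub_const (Complex.exp (B * (u : ℂ) ^ 2))
      have h3 : ((Real.exp (B * u ^ 2) : ℝ) : ℂ) - Complex.exp (B * (u : ℂ) ^ 2) = 0 := by
        push_cast; ring
      rw [h3] at h2
      refine h2.congr fun n => ?_
      simp only [Function.comp]
      rw [Complex.ofReal_tsum]
      push_cast
      rfl) hwR
  have := (hz.congr' (hdiff w hwR.le)).add_const (Complex.exp (B * w ^ 2))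
  simpa using this

/-! ### A local limit theorem for coefficients of nonnegative power series -/

theorem integral_cexp_int_mul_I (k : ℤ) :
    ∫ θ in (-π)..π, Complex.exp (k * Complex.I * θ) = if k = 0 then (2 * π : ℂ) else 0 := by
  split_ifs with hk
  · subst hk
    simp
    ring
  · have hk' : (k : ℂ) * Complex.I ≠ 0 := mul_ne_zero (by exact_mod_cast hk) Complex.I_ne_zero
    rw [integral_exp_mul_complex hk', div_eq_zero_iff]
    left
    rw [sub_eq_zero, Complex.exp_eq_exp_iff_exists_int]
    exact ⟨k, by push_cast; ring⟩

theorem integral_fourier_tsum {b : ℕ → ℝ} (hb0 : ∀ m, 0 ≤ b m) (hb : Summable b) (n : ℕ) :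
    ∫ θ in (-π)..π, ∑' m, (b m : ℂ) * Complex.exp (Complex.I * θ * ((m : ℝ) - (n : ℝ) : ℝ)) =
      2 * π * b n := by
  have h := intervalIntegral.hasSum_integral_of_dominated_convergence
    (μ := MeasureTheory.volume) (a := -π) (b := π)
    (F := fun m (θ : ℝ) => (b m : ℂ) * Complex.exp (Complex.I * θ * ((m : ℝ) - (n : ℝ) : ℝ)))
    (f := fun θ => ∑' m, (b m : ℂ) * Complex.exp (Complex.I * θ * ((m : ℝ) - (n : ℝ) : ℝ)))
    (fun m _ => b m) (fun m => by
      apply Continuous.aestronglyMeasurable; fun_prop) (fun m => Eventually.of_forall fun θ _ => by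
      rw [norm_mul, Complex.norm_real, Real.norm_of_nonneg (hb0 m),
        show Complex.I * (θ : ℂ) * (((m : ℝ) - (n : ℝ) : ℝ) : ℂ) =
          ((θ * ((m : ℝ) - (n : ℝ)) : ℝ) : ℂ) * Complex.I by push_cast; ring,
        Complex.norm_exp_ofReal_mul_I, mul_one])
    (Eventually.of_forall fun θ _ => hb) (by simp)
    (Eventually.of_forall fun θ _ => by
      refine Summable.hasSum (hb.of_norm_bounded fun m => ?_)
      rw [norm_mul, Complex.norm_real, Real.norm_of_nonneg (hb0 m),
        show Complex.I * (θ : ℂ) * (((m : ℝ) - (n : ℝ) : ℝ) : ℂ) =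
          ((θ * ((m : ℝ) - (n : ℝ)) : ℝ) : ℂ) * Complex.I by push_cast; ring,
        Complex.norm_exp_ofReal_mul_I, mul_one])
  rw [← h.tsum_eq, tsum_eq_single n]
  · simp
    left; ring
  · intro m hm
    rw [intervalIntegral.integral_const_mul]
    have := integral_cexp_int_mul_I ((m : ℤ) - n)
    rw [if_neg (by omega)] at this
    rw [show (fun θ : ℝ => Complex.exp (Complex.I * θ * (((m : ℝ) - (n : ℝ) : ℝ) : ℂ))) =
      fun θ : ℝ => Complex.exp ((((m : ℤ) - n : ℤ) : ℂ) * Complex.I * θ) by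
        funext θ; congr 1; push_cast; ring, this, mul_zero]

section LocalLimit

variable {a : ℕ → ℝ} {B C D c : ℝ}

/-- With `x' = x(1-u√x)` one has `B/x' = B/x + uB/√x + Bu²/(1-u√x)`. The first term cancels in the
ratio, the second is removed by centring at `B/x²`, and the third tends to `Bu²`; the power
`(x'/x)^(-D)` tends to `1`. -/
theorem tendsto_ratio_boltzmann (hC : 0 < C)
    (hF : Tendsto (fun x => (∑' n, a n * Real.exp (-(x * n))) / (C * x ^ (-D) * Real.exp (B / x)))
      (𝓝[>] 0) (𝓝 1)) (u : ℝ) :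
    Tendsto (fun x : ℝ => (∑' n, a n * Real.exp (-((x - u * (x * √x)) * n))) /
      (∑' n, a n * Real.exp (-(x * n))) * Real.exp (-(u * (B / x ^ 2 * (x * √x)))))
      (𝓝[>] 0) (𝓝 (Real.exp (B * u ^ 2))) := by
  have hsq : Tendsto (fun x : ℝ => 1 - u * √x) (𝓝[>] 0) (𝓝 1) := by
    have : Tendsto (fun x : ℝ => 1 - u * √x) (𝓝 0) (𝓝 (1 - u * √0)) :=
      Continuous.tendsto (by fun_prop) 0
    rw [Real.sqrt_zero, mul_zero, sub_zero] at this
    exact this.mono_left nhdsWithin_le_nhds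
  have hpos : ∀ᶠ x : ℝ in 𝓝[>] 0, 0 < 1 - u * √x := hsq.eventually_const_lt one_pos
  have hx' : Tendsto (fun x : ℝ => x - u * (x * √x)) (𝓝[>] 0) (𝓝[>] 0) := by
    refine tendsto_nhdsWithin_iff.2 ⟨?_, ?_⟩
    · have : Tendsto (fun x : ℝ => x - u * (x * √x)) (𝓝 0) (𝓝 (0 - u * (0 * √0))) :=
        Continuous.tendsto (by fun_prop) 0
      rw [zero_mul, mul_zero, sub_zero] at this
      exact this.mono_left nhdsWithin_le_nhds
    · filter_upwards [self_mem_nhdsWithin, hpos] with x (hx : 0 < x) h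
      have := mul_pos hx h
      simp only [Set.mem_Ioi]
      linarith
  have h1 := (hF.comp hx').div hF one_ne_zero
  have h2 : Tendsto (fun x : ℝ => (1 - u * √x) ^ (-D) * Real.exp (B * u ^ 2 / (1 - u * √x)))
      (𝓝[>] 0) (𝓝 (1 ^ (-D) * Real.exp (B * u ^ 2 / 1))) :=
    (hsq.rpow_const (Or.inl one_ne_zero)).mul
      ((Real.continuous_exp.tendsto _).comp (tendsto_const_nhds.div hsq one_ne_zero))
  have h3 := h1.mul h2
  simp only [Real.one_rpow, div_one, one_mul] at h3
  refine h3.congr' ?_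
  filter_upwards [self_mem_nhdsWithin, hpos] with x (hx : 0 < x) h
  simp only [Function.comp, Pi.div_apply]
  have hr : (x - u * (x * √x)) ^ (-D) = x ^ (-D) * (1 - u * √x) ^ (-D) := by
    rw [← Real.mul_rpow hx.le h.le]; congr 1; ring
  have hs : √x ^ 2 = x := Real.sq_sqrt hx.le
  have he : B / (x - u * (x * √x)) = B / x + u * (B / x ^ 2 * (x * √x)) +
      B * u ^ 2 / (1 - u * √x) := by
    rw [show x - u * (x * √x) = x * (1 - u * √x) by ring]
    obtain ⟨r, hr⟩ : ∃ r, r = √x := ⟨_, rfl⟩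
    rw [← hr] at hs h ⊢
    have hr0 : r ≠ 0 := by rintro rfl; simp at hs; exact hx.ne hs
    rw [← hs]
    obtain ⟨q, hq⟩ : ∃ q, q = 1 - u * r := ⟨_, rfl⟩
    rw [← hq] at h ⊢
    field_simp
    rw [hq]
    ring
  rw [hr, he, Real.exp_add, Real.exp_add, Real.exp_neg]
  have p1 : 0 < x ^ (-D) := Real.rpow_pos_of_pos hx _
  have p2 : 0 < (1 - u * √x) ^ (-D) := Real.rpow_pos_of_pos h _
  have p3 := Real.exp_pos (B / x)
  have p4 := Real.exp_pos (B * u ^ 2 / (1 - u * √x))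
  have p5 := Real.exp_pos (u * (B / x ^ 2 * (x * √x)))
  field_simp

/-- For real `u`, the factor `e^(uy)` with `y = (m - B/x²) x^(3/2)` replaces `x` by `x - u x^(3/2)`
in the weights, so the moment generating function is the ratio treated in `tendsto_ratio_boltzmann`.
-/
theorem tendsto_charFun_boltzmann (ha : ∀ n, 0 ≤ a n)
    (hs : ∀ x : ℝ, 0 < x → Summable fun n : ℕ => a n * Real.exp (-(x * n)))
    (hB : 0 < B) (hC : 0 < C)
    (hF : Tendsto (fun x => (∑' n, a n * Real.exp (-(x * n))) / (C * x ^ (-D) * Real.exp (B / x)))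
      (𝓝[>] 0) (𝓝 1)) (w : ℂ) :
    Tendsto (fun x : ℝ => ∑' m : ℕ,
        ((a m * Real.exp (-(x * m)) / ∑' n, a n * Real.exp (-(x * n)) : ℝ) : ℂ) *
          Complex.exp (w * (((m : ℝ) - B / x ^ 2) * (x * √x) : ℝ)))
      (𝓝[>] 0) (𝓝 (Complex.exp (B * w ^ 2))) := by
  have heq (u x : ℝ) (m : ℕ) : a m * Real.exp (-(x * m)) / (∑' n, a n * Real.exp (-(x * n))) *
      Real.exp (u * (((m : ℝ) - B / x ^ 2) * (x * √x))) =
      a m * Real.exp (-((x - u * (x * √x)) * m)) *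
        ((∑' n, a n * Real.exp (-(x * n)))⁻¹ * Real.exp (-(u * (B / x ^ 2 * (x * √x))))) := by
    have : Real.exp (-(x * m)) * Real.exp (u * (((m : ℝ) - B / x ^ 2) * (x * √x))) =
        Real.exp (-((x - u * (x * √x)) * m)) * Real.exp (-(u * (B / x ^ 2 * (x * √x)))) := by
      rw [← Real.exp_add, ← Real.exp_add]; congr 1; ring
    rw [div_eq_mul_inv]
    linear_combination a m * (∑' n, a n * Real.exp (-(x * n)))⁻¹ * this
  refine tendsto_tsum_cexp_of_tendsto_tsum_exp
    (p := fun x m => a m * Real.exp (-(x * m)) / ∑' n, a n * Real.exp (-(x * n)))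
    (y := fun x m => ((m : ℝ) - B / x ^ 2) * (x * √x)) hB.le
    (fun x m => div_nonneg (mul_nonneg (ha m) (Real.exp_pos _).le)
      (tsum_nonneg fun n => mul_nonneg (ha n) (Real.exp_pos _).le)) (fun u => ?_) (fun u => ?_) w
  · have hsq : Tendsto (fun x : ℝ => 1 - u * √x) (𝓝[>] 0) (𝓝 1) := by
      have : Tendsto (fun x : ℝ => 1 - u * √x) (𝓝 0) (𝓝 (1 - u * √0)) :=
        Continuous.tendsto (by fun_prop) 0
      rw [Real.sqrt_zero, mul_zero, sub_zero] at this
      exact this.mono_left nhdsWithin_le_nhds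
    filter_upwards [self_mem_nhdsWithin, hsq.eventually_const_lt one_pos] with x (hx : 0 < x) h
    simp_rw [heq]
    refine (hs _ ?_).mul_right _
    have := mul_pos hx h
    linarith
  · simp_rw [heq, tsum_mul_right]
    refine (tendsto_ratio_boltzmann hC hF u).congr fun x => ?_
    rw [div_eq_mul_inv]; ring

/-- This supplies an integrable majorant independent of `x`. Where the minimum is `1/x`, the factor
`e^(-c/x) ≤ 6x³/c³` absorbs `v² ≤ π²/x³`. -/
theorem exp_neg_mul_min_le {c x v : ℝ} (hc : 0 < c) (hx : 0 < x) (hx1 : x ≤ 1)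
    (hv : |v| ≤ π / (x * √x)) :
    Real.exp (-c * min (1 / x) (v ^ 2)) ≤
      (6 / c ^ 3 * (1 + π ^ 2) + (1 + 1 / c)) * (1 + v ^ 2)⁻¹ := by
  rw [← div_eq_mul_inv, le_div_iff₀ (by positivity)]
  have hA : 0 ≤ 6 / c ^ 3 * (1 + π ^ 2) := by positivity
  have hB : 0 ≤ 1 + 1 / c := by positivity
  rcases min_choice (1 / x) (v ^ 2) with h | h <;> rw [h]
  · have h1 : v ^ 2 ≤ π ^ 2 / x ^ 3 := by
      have h2 : v ^ 2 ≤ (π / (x * √x)) ^ 2 := by rw [← sq_abs]; gcongr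
      rw [div_pow, mul_pow, Real.sq_sqrt hx.le] at h2
      refine h2.trans (le_of_eq ?_)
      ring
    have h3 : Real.exp (-c * (1 / x)) ≤ 6 / c ^ 3 * x ^ 3 := by
      have h4 := Real.pow_div_factorial_le_exp (c / x) (by positivity) 3
      rw [show -c * (1 / x) = -(c / x) by ring, Real.exp_neg]
      rw [inv_le_comm₀ (Real.exp_pos _) (by positivity)]
      refine le_trans (le_of_eq ?_) h4
      simp [Nat.factorial]
      field_simp
    have hx3 : x ^ 3 ≤ 1 := pow_le_one₀ hx.le hx1
    calc _ ≤ 6 / c ^ 3 * x ^ 3 * (1 + π ^ 2 / x ^ 3) := by gcongr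
      _ = 6 / c ^ 3 * (x ^ 3 + π ^ 2) := by field_simp
      _ ≤ 6 / c ^ 3 * (1 + π ^ 2) := by gcongr
      _ ≤ _ := by linarith
  · have h1 := Real.add_one_le_exp (c * v ^ 2)
    have h2 : Real.exp (-c * v ^ 2) ≤ (c * v ^ 2 + 1)⁻¹ := by
      rw [neg_mul, Real.exp_neg]; gcongr
    calc _ ≤ (c * v ^ 2 + 1)⁻¹ * (1 + v ^ 2) := by gcongr
      _ ≤ 1 + 1 / c := by
        rw [inv_mul_le_iff₀ (by positivity)]
        have : (c * v ^ 2 + 1) * (1 + 1 / c) = 1 + v ^ 2 + (c * v ^ 2 + 1 / c) := by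
          field_simp; ring
        rw [this]
        have : 0 ≤ c * v ^ 2 + 1 / c := by positivity
        linarith
      _ ≤ _ := by linarith

/-- After the scaling `θ = x^(3/2) v` the integrand converges pointwise to `e^(-Bv²)` and the window
exhausts the line. The off-axis bound `hm` provides domination, since `θ²/x³ = v²`. -/
theorem tendsto_integral_boltzmann (ha : ∀ n, 0 ≤ a n)
    (hs : ∀ x : ℝ, 0 < x → Summable fun n : ℕ => a n * Real.exp (-(x * n)))
    (hB : 0 < B) (hC : 0 < C) (hc : 0 < c)
    (hF : Tendsto (fun x => (∑' n, a n * Real.exp (-(x * n))) / (C * x ^ (-D) * Real.exp (B / x)))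
      (𝓝[>] 0) (𝓝 1))
    (hm : ∀ᶠ x : ℝ in 𝓝[>] 0, ∀ θ : ℝ, |θ| ≤ π →
      ‖∑' n : ℕ, (a n : ℂ) * Complex.exp ((-x + θ * Complex.I) * n)‖ ≤
        (∑' n, a n * Real.exp (-(x * n))) * Real.exp (-c * min (1 / x) (θ ^ 2 / x ^ 3))) :
    Tendsto (fun x : ℝ => ∫ v : ℝ, (Set.Ioc (-(π / (x * √x))) (π / (x * √x))).indicator (fun v =>
      ∑' m : ℕ, ((a m * Real.exp (-(x * m)) / ∑' n, a n * Real.exp (-(x * n)) : ℝ) : ℂ) *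
          Complex.exp (Complex.I * v * (((m : ℝ) - B / x ^ 2) * (x * √x) : ℝ))) v)
      (𝓝[>] 0) (𝓝 (√(π / B) : ℝ)) := by
  have hgauss : ((√(π / B) : ℝ) : ℂ) = ∫ v : ℝ, Complex.exp (B * (Complex.I * v) ^ 2) := by
    rw [← integral_gaussian, ← integral_complex_ofReal]
    refine MeasureTheory.integral_congr_ae (Eventually.of_forall fun v => ?_)
    simp only
    push_cast
    rw [mul_pow, Complex.I_sq]
    congr 1; ring
  rw [hgauss]
  refine MeasureTheory.tendsto_integral_filter_of_dominated_convergence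
    (fun v => (6 / c ^ 3 * (1 + π ^ 2) + (1 + 1 / c)) * (1 + v ^ 2)⁻¹) ?_ ?_
    (integrable_inv_one_add_sq.const_mul _) ?_
  · filter_upwards [self_mem_nhdsWithin] with x (hx : 0 < x)
    refine MeasureTheory.AEStronglyMeasurable.indicator (Continuous.aestronglyMeasurable ?_)
      measurableSet_Ioc
    refine continuous_tsum (fun m => by fun_prop)
      ((hs x hx).div_const (∑' n, a n * Real.exp (-(x * n)))) fun m v => ?_
    rw [norm_mul, Complex.norm_real, Real.norm_of_nonneg (div_nonneg
      (mul_nonneg (ha m) (Real.exp_pos _).le)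
      (tsum_nonneg fun n => mul_nonneg (ha n) (Real.exp_pos _).le)),
      show Complex.I * (v : ℂ) * ((((m : ℝ) - B / x ^ 2) * (x * √x) : ℝ) : ℂ) =
          ((v * (((m : ℝ) - B / x ^ 2) * (x * √x)) : ℝ) : ℂ) * Complex.I by push_cast; ring,
      Complex.norm_exp_ofReal_mul_I, mul_one]
  · filter_upwards [self_mem_nhdsWithin, hm, Ioc_mem_nhdsGT one_pos,
      hF.eventually_const_lt one_pos] with x (hx : 0 < x) hmx hx1 hpos
    refine Eventually.of_forall fun v => ?_
    have hFx : 0 < ∑' n, a n * Real.exp (-(x * n)) := by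
      have : 0 < C * x ^ (-D) * Real.exp (B / x) := by positivity
      exact (div_pos_iff_of_pos_right this).1 hpos
    have hh : 0 < x * √x := by positivity
    by_cases hv : v ∈ Set.Ioc (-(π / (x * √x))) (π / (x * √x))
    · rw [Set.indicator_of_mem hv]
      have hv' : |v| ≤ π / (x * √x) := abs_le.2 ⟨hv.1.le, hv.2⟩
      refine le_trans ?_ (exp_neg_mul_min_le hc hx hx1.2 hv')
      have hθ : |x * √x * v| ≤ π := by
        rw [abs_mul, abs_of_pos hh, ← le_div_iff₀' hh]; exact hv'
      have h1 := hmx _ hθ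
      have h2 : (x * √x * v) ^ 2 / x ^ 3 = v ^ 2 := by
        rw [mul_pow, mul_pow, Real.sq_sqrt hx.le]; field_simp
      rw [h2] at h1
      -- Centring contributes only a phase independent of `m`, so the norm of the sum is that of the
      -- series at `-x+iθ` divided by its value at `θ = 0`.
      have h3 (m : ℕ) : ((a m * Real.exp (-(x * m)) / ∑' n, a n * Real.exp (-(x * n)) : ℝ) : ℂ) *
          Complex.exp (Complex.I * v * (((m : ℝ) - B / x ^ 2) * (x * √x) : ℝ)) =
          (a m : ℂ) * Complex.exp ((-x + (x * √x * v : ℝ) * Complex.I) * m) *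
            (Complex.exp ((-(v * (B / x ^ 2 * (x * √x))) : ℝ) * Complex.I) /
              ((∑' n, a n * Real.exp (-(x * n)) : ℝ) : ℂ)) := by
        have : Complex.exp (-(x * m)) *
            Complex.exp (Complex.I * v * (((m : ℝ) - B / x ^ 2) * (x * √x) : ℝ)) =
            Complex.exp ((-x + (x * √x * v : ℝ) * Complex.I) * m) *
            Complex.exp ((-(v * (B / x ^ 2 * (x * √x))) : ℝ) * Complex.I) := by
          rw [← Complex.exp_add, ← Complex.exp_add]
          congr 1; push_cast; ring
        have hd : ((a m * Real.exp (-(x * m)) / ∑' n, a n * Real.exp (-(x * n)) : ℝ) : ℂ) =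
            (a m : ℂ) * Complex.exp (-(x * m)) / ((∑' n, a n * Real.exp (-(x * n)) : ℝ) : ℂ) := by
          rw [Complex.ofReal_div]; push_cast; rfl
        rw [hd]
        linear_combination (a m : ℂ) / ((∑' n, a n * Real.exp (-(x * n)) : ℝ) : ℂ) * this
      simp_rw [h3]
      rw [tsum_mul_right, norm_mul, norm_div, Complex.norm_exp_ofReal_mul_I, Complex.norm_real,
        Real.norm_of_nonneg hFx.le, mul_one_div, div_le_iff₀ hFx, mul_comm (Real.exp _)]
      exact h1
    · rw [Set.indicator_of_notMem hv, norm_zero]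
      positivity
  · refine Eventually.of_forall fun v => ?_
    have h1 := tendsto_charFun_boltzmann ha hs hB hC hF (Complex.I * v)
    refine h1.congr' ?_
    have hh : Tendsto (fun x : ℝ => |v| * (x * √x)) (𝓝[>] 0) (𝓝 0) := by
      have : Tendsto (fun x : ℝ => |v| * (x * √x)) (𝓝 0) (𝓝 (|v| * (0 * √0))) :=
        Continuous.tendsto (by fun_prop) 0
      rw [zero_mul, mul_zero] at this
      exact this.mono_left nhdsWithin_le_nhds
    filter_upwards [self_mem_nhdsWithin, hh.eventually_lt_const pi_pos] with x (hx : 0 < x) hlt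
    rw [Set.indicator_of_mem]
    rw [← lt_div_iff₀ (by positivity)] at hlt
    exact ⟨(abs_lt.1 hlt).1, (abs_lt.1 hlt).2.le⟩

theorem coeff_mul_exp_eq_integral (ha : ∀ n, 0 ≤ a n) {x : ℝ} (hx : 0 < x)
    (hs : Summable fun n : ℕ => a n * Real.exp (-(x * n))) {n : ℕ} (hn : (n : ℝ) = B / x ^ 2) :
    ((2 * π * (a n * Real.exp (-(x * n)) / ∑' n, a n * Real.exp (-(x * n))) / (x * √x) : ℝ) : ℂ) =
      ∫ v : ℝ, (Set.Ioc (-(π / (x * √x))) (π / (x * √x))).indicator (fun v =>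
      ∑' m : ℕ, ((a m * Real.exp (-(x * m)) / ∑' n, a n * Real.exp (-(x * n)) : ℝ) : ℂ) *
          Complex.exp (Complex.I * v * (((m : ℝ) - B / x ^ 2) * (x * √x) : ℝ))) v := by
  have hh : 0 < x * √x := by positivity
  have h1 := integral_fourier_tsum
    (b := fun m => a m * Real.exp (-(x * m)) / ∑' n, a n * Real.exp (-(x * n)))
    (fun m => div_nonneg (mul_nonneg (ha m) (Real.exp_pos _).le)
      (tsum_nonneg fun n => mul_nonneg (ha n) (Real.exp_pos _).le)) (hs.div_const _) n
  rw [MeasureTheory.integral_indicator measurableSet_Ioc,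
    ← intervalIntegral.integral_of_le (by
      have : 0 < π / (x * √x) := div_pos pi_pos hh
      linarith)]
  have h2 := intervalIntegral.integral_comp_mul_left (a := -(π / (x * √x))) (b := π / (x * √x))
    (fun θ : ℝ => ∑' m : ℕ,
      ((a m * Real.exp (-(x * m)) / ∑' n, a n * Real.exp (-(x * n)) : ℝ) : ℂ) *
          Complex.exp (Complex.I * θ * ((m : ℝ) - (n : ℝ) : ℝ))) hh.ne'
  rw [mul_neg, mul_div_cancel₀ _ hh.ne', h1] at h2
  rw [show (fun v : ℝ => ∑' m : ℕ,
      ((a m * Real.exp (-(x * m)) / ∑' n, a n * Real.exp (-(x * n)) : ℝ) : ℂ) *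
        Complex.exp (Complex.I * v * (((m : ℝ) - B / x ^ 2) * (x * √x) : ℝ))) =
      fun v : ℝ => ∑' m : ℕ,
      ((a m * Real.exp (-(x * m)) / ∑' n, a n * Real.exp (-(x * n)) : ℝ) : ℂ) *
        Complex.exp (Complex.I * ((x * √x * v : ℝ) : ℂ) * ((m : ℝ) - (n : ℝ) : ℝ)) by
    funext v
    refine tsum_congr fun m => ?_
    rw [hn]
    congr 2
    push_cast; ring]
  rw [h2, Complex.real_smul, div_eq_inv_mul, Complex.ofReal_mul, Complex.ofReal_mul]
  push_cast
  rfl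

/-- At the saddle point `x = √(B/n)` both `xn` and `B/x` equal `√(Bn)`. Inversion gives `a_n ~
x^(3/2) e^(xn) F(x) √(π/B)/(2π)`, into which the growth of `F` is inserted. -/
theorem isEquivalent_of_boltzmann (ha : ∀ n, 0 ≤ a n)
    (hs : ∀ x : ℝ, 0 < x → Summable fun n : ℕ => a n * Real.exp (-(x * n)))
    (hB : 0 < B) (hC : 0 < C) (hc : 0 < c)
    (hF : Tendsto (fun x => (∑' n, a n * Real.exp (-(x * n))) / (C * x ^ (-D) * Real.exp (B / x)))
      (𝓝[>] 0) (𝓝 1))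
    (hm : ∀ᶠ x : ℝ in 𝓝[>] 0, ∀ θ : ℝ, |θ| ≤ π →
      ‖∑' n : ℕ, (a n : ℂ) * Complex.exp ((-x + θ * Complex.I) * n)‖ ≤
        (∑' n, a n * Real.exp (-(x * n))) * Real.exp (-c * min (1 / x) (θ ^ 2 / x ^ 3))) :
    a ~[atTop] fun n : ℕ => C * B ^ (1 / 4 - D / 2) / (2 * √π) * (n : ℝ) ^ (D / 2 - 3 / 4) *
      Real.exp (2 * √(B * n)) := by
  have hx : Tendsto (fun n : ℕ => √(B / n)) atTop (𝓝[>] 0) := by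
    refine tendsto_nhdsWithin_iff.2 ⟨?_, ?_⟩
    · have := (Real.continuous_sqrt.tendsto 0).comp (tendsto_const_div_atTop_nhds_zero_nat B)
      rwa [Real.sqrt_zero] at this
    · filter_upwards [eventually_gt_atTop 0] with n hn
      have : (0 : ℝ) < n := by exact_mod_cast hn
      exact Real.sqrt_pos.2 (by positivity)
  have h1 := (tendsto_integral_boltzmann ha hs hB hC hc hF hm).comp hx
  have h2 : Tendsto (fun n : ℕ => 2 * π * (a n * Real.exp (-(√(B / n) * n)) /
      ∑' m, a m * Real.exp (-(√(B / n) * m))) / (√(B / n) * √√(B / n))) atTop (𝓝 √(π / B)) := by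
    have h3 : Tendsto (fun n : ℕ => ((2 * π * (a n * Real.exp (-(√(B / n) * n)) /
      ∑' m, a m * Real.exp (-(√(B / n) * m))) / (√(B / n) * √√(B / n)) : ℝ) : ℂ)) atTop
        (𝓝 (√(π / B) : ℝ)) := by
      refine h1.congr' ?_
      filter_upwards [eventually_gt_atTop 0] with n hn
      have hn' : (0 : ℝ) < n := by exact_mod_cast hn
      have hxn : 0 < √(B / n) := Real.sqrt_pos.2 (by positivity)
      refine (coeff_mul_exp_eq_integral ha hxn (hs _ hxn) ?_).symm
      rw [Real.sq_sqrt (by positivity)]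
      field_simp
    exact (Complex.continuous_re.tendsto _).comp h3
  have h4 := (h2.mul (hF.comp hx)).div_const √(π / B)
  have hsq : 0 < √(π / B) := Real.sqrt_pos.2 (by positivity)
  rw [mul_one, div_self hsq.ne'] at h4
  have hpos : ∀ᶠ n : ℕ in atTop, 0 < C * B ^ (1 / 4 - D / 2) / (2 * √π) *
      (n : ℝ) ^ (D / 2 - 3 / 4) * Real.exp (2 * √(B * n)) := by
    filter_upwards [eventually_gt_atTop 0] with n hn
    have hn' : (0 : ℝ) < n := by exact_mod_cast hn
    positivity
  rw [isEquivalent_iff_tendsto_one (hpos.mono fun n hn => hn.ne')]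
  refine h4.congr' ?_
  filter_upwards [eventually_gt_atTop 0, hx.eventually (hF.eventually_const_lt one_pos)]
    with n hn hFn
  have hn' : (0 : ℝ) < n := by exact_mod_cast hn
  simp only [Function.comp, Pi.div_apply]
  have hexp1 : √(B / n) * n = √(B * n) := by
    rw [← Real.sqrt_sq hn'.le, ← Real.sqrt_mul (by positivity), Real.sqrt_sq hn'.le]
    congr 1; field_simp
  have hexp2 : B / √(B / n) = √(B * n) := by
    rw [div_eq_iff (by positivity), ← Real.sqrt_mul (by positivity)]
    rw [show B * n * (B / n) = B ^ 2 by field_simp, Real.sqrt_sq hB.le]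
  have hF0 : 0 < ∑' m, a m * Real.exp (-(√(B / n) * m)) := by
    have : 0 < C * √(B / n) ^ (-D) * Real.exp (B / √(B / n)) := by positivity
    exact (div_pos_iff_of_pos_right this).1 hFn
  have hpow : √(B / n) * √√(B / n) * √(B / n) ^ (-D) * √(π / B) / (2 * π) =
      B ^ (1 / 4 - D / 2) / (2 * √π) * (n : ℝ) ^ (D / 2 - 3 / 4) := by
    have e1 : √(π / B) / (2 * π) = B ^ (-(1 / 2) : ℝ) / (2 * √π) := by
      rw [Real.sqrt_div pi_pos.le, Real.rpow_neg hB.le, ← Real.sqrt_eq_rpow]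
      have : π = √π ^ 2 := (Real.sq_sqrt pi_pos.le).symm
      have hp : 0 < √π := Real.sqrt_pos.2 pi_pos
      have hb : 0 < √B := Real.sqrt_pos.2 hB
      nth_rewrite 2 [this]
      field_simp
    have e2 : √(B / n) * √√(B / n) * √(B / n) ^ (-D) =
        B ^ (3 / 4 - D / 2) * (n : ℝ) ^ (D / 2 - 3 / 4) := by
      have hBn : 0 < B / n := by positivity
      simp only [Real.sqrt_eq_rpow]
      rw [← Real.rpow_mul hBn.le, ← Real.rpow_mul hBn.le, ← Real.rpow_add hBn,
        ← Real.rpow_add hBn, Real.div_rpow hB.le hn'.le, div_eq_mul_inv,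
        ← Real.rpow_neg hn'.le]
      congr 2 <;> ring
    rw [mul_div_assoc, e1, e2]
    rw [show B ^ (1 / 4 - D / 2) = B ^ (3 / 4 - D / 2) * B ^ (-(1 / 2) : ℝ) by
      rw [← Real.rpow_add hB]; congr 1; ring]
    ring
  rw [mul_div_assoc C, mul_assoc C (_ / _), ← hpow, hexp1, hexp2,
    show (2 : ℝ) * √(B * n) = √(B * n) + √(B * n) by ring, Real.exp_add, Real.exp_neg]
  have q1 : 0 < √(B / n) := Real.sqrt_pos.2 (by positivity)
  have q2 : 0 < √√(B / n) := Real.sqrt_pos.2 q1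
  have q3 : 0 < √(B / n) ^ (-D) := Real.rpow_pos_of_pos q1 _
  have q4 := Real.exp_pos √(B * n)
  rw [hexp1.symm] at q4 ⊢
  field_simp

end LocalLimit

/-! ### Lower bounds for `∑ (1 - cos nθ)` over arithmetic progressions -/

theorem one_sub_cos_nonneg (x : ℝ) : 0 ≤ 1 - Real.cos x := by linarith [Real.cos_le_one x]

/-- Since `1 - cos a = |1-e^(ia)|²/2`, this is the triangle inequality combined with `(p+q)² ≤ 2p² +
2q²`. -/
theorem one_sub_cos_sub_le (a b : ℝ) :
    1 - Real.cos (a - b) ≤ 2 * (1 - Real.cos a) + 2 * (1 - Real.cos b) := by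
  rw [Real.cos_sub]
  nlinarith [sq_nonneg (2 - Real.cos a - Real.cos b), sq_nonneg (Real.sin a + Real.sin b),
    Real.sin_sq_add_cos_sq a, Real.sin_sq_add_cos_sq b]

/-- `∑_{k < 2N} (1 - cos ((sk+t)θ))`. -/
noncomputable def cosDefect (s t N : ℕ) (θ : ℝ) : ℝ :=
  ∑ k ∈ Finset.range (2 * N), (1 - Real.cos ((s * k + t : ℕ) * θ))

theorem cosDefect_nonneg (s t N : ℕ) (θ : ℝ) : 0 ≤ cosDefect s t N θ :=
  Finset.sum_nonneg fun _ _ => one_sub_cos_nonneg _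

theorem sum_shift_le_cosDefect (s t N : ℕ) (θ : ℝ) {j : ℕ} (hj : j ≤ N) :
    ∑ k ∈ Finset.range N, (1 - Real.cos ((s * (k + j) + t : ℕ) * θ)) ≤ cosDefect s t N θ := by
  unfold cosDefect
  rw [← Finset.sum_image (s := Finset.range N) (g := fun k => k + j)
    (f := fun k => 1 - Real.cos ((s * k + t : ℕ) * θ)) fun a _ b _ h => by simpa using h]
  refine Finset.sum_le_sum_of_subset_of_nonneg ?_ fun _ _ _ => one_sub_cos_nonneg _
  intro m hm
  simp only [Finset.mem_image, Finset.mem_range] at hm ⊢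
  omega

/-- The phase `jsθ` is the difference of the phases at indices `k+j` and `k`. Summing over `k < N`
keeps both below `2N`, which is why `cosDefect` runs that far. -/
theorem mul_one_sub_cos_modulus_le (s t N : ℕ) (θ : ℝ) {j : ℕ} (hj : j ≤ N) :
    N * (1 - Real.cos ((j * s : ℕ) * θ)) ≤ 4 * cosDefect s t N θ := by
  have h1 := sum_shift_le_cosDefect s t N θ hj
  have h2 := sum_shift_le_cosDefect s t N θ (Nat.zero_le N)
  calc N * (1 - Real.cos ((j * s : ℕ) * θ))
      = ∑ k ∈ Finset.range N, (1 - Real.cos ((j * s : ℕ) * θ)) := by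
        rw [Finset.sum_const, Finset.card_range, nsmul_eq_mul]
    _ ≤ ∑ k ∈ Finset.range N, (2 * (1 - Real.cos ((s * (k + j) + t : ℕ) * θ)) +
        2 * (1 - Real.cos ((s * (k + 0) + t : ℕ) * θ))) := by
        refine Finset.sum_le_sum fun k _ => ?_
        refine le_trans (le_of_eq ?_) (one_sub_cos_sub_le _ _)
        congr 2; push_cast; ring
    _ ≤ _ := by
        rw [Finset.sum_add_distrib, ← Finset.mul_sum, ← Finset.mul_sum]
        linarith

/-- Write `tθ` as `(sk+t)θ - skθ` and average over `k`; the constant is `2 + 2·4`. -/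
theorem mul_one_sub_cos_residue_le (s t N : ℕ) (θ : ℝ) :
    N * (1 - Real.cos (t * θ)) ≤ 10 * cosDefect s t N θ := by
  rcases Nat.eq_zero_or_pos N with rfl | hN
  · simpa using cosDefect_nonneg s t 0 θ
  have h2 := sum_shift_le_cosDefect s t N θ (Nat.zero_le N)
  have hN' : (0 : ℝ) < N := by exact_mod_cast hN
  have h3 : ∑ k ∈ Finset.range N, (1 - Real.cos ((k * s : ℕ) * θ)) ≤ 4 * cosDefect s t N θ := by
    calc _ ≤ ∑ k ∈ Finset.range N, 4 * cosDefect s t N θ / N := by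
          refine Finset.sum_le_sum fun k hk => ?_
          rw [le_div_iff₀' hN']
          exact mul_one_sub_cos_modulus_le s t N θ (Finset.mem_range.1 hk).le
      _ = _ := by simp; field_simp
  calc N * (1 - Real.cos (t * θ)) = ∑ k ∈ Finset.range N, (1 - Real.cos (t * θ)) := by
        rw [Finset.sum_const, Finset.card_range, nsmul_eq_mul]
    _ ≤ ∑ k ∈ Finset.range N, (2 * (1 - Real.cos ((s * (k + 0) + t : ℕ) * θ)) +
        2 * (1 - Real.cos ((k * s : ℕ) * θ))) := by
        refine Finset.sum_le_sum fun k _ => ?_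
        refine le_trans (le_of_eq ?_) (one_sub_cos_sub_le _ _)
        congr 2; push_cast; ring
    _ ≤ _ := by
        rw [Finset.sum_add_distrib, ← Finset.mul_sum, ← Finset.mul_sum]
        linarith

section Family

variable {ι : Type*} [Fintype ι] {s t : ι → ℕ}

/-- The integers `n` for which `N(1-cos nθ)` is bounded by a multiple of the total defect, uniformly
in `N` and `θ`, form a subgroup of `ℤ`. It contains every `sᵢ` and `tᵢ`, so the gcd hypothesis puts
`1` in it. -/
theorem exists_mul_one_sub_cos_le (hgcd : ∀ d : ℕ, (∀ i, d ∣ s i ∧ d ∣ t i) → d = 1) :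
    ∃ K : ℝ, 0 < K ∧ ∀ (N : ℕ) (θ : ℝ), 1 ≤ N →
      N * (1 - Real.cos θ) ≤ K * ∑ i, cosDefect (s i) (t i) N θ := by
  have hT (N : ℕ) (θ : ℝ) : 0 ≤ ∑ i, cosDefect (s i) (t i) N θ :=
    Finset.sum_nonneg fun i _ => cosDefect_nonneg _ _ _ _
  have hle (i : ι) (N : ℕ) (θ : ℝ) :
      cosDefect (s i) (t i) N θ ≤ ∑ i, cosDefect (s i) (t i) N θ :=
    Finset.single_le_sum (f := fun i => cosDefect (s i) (t i) N θ)
      (fun i _ => cosDefect_nonneg _ _ _ _) (Finset.mem_univ i)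
  let H : AddSubgroup ℤ :=
    { carrier := {n | ∃ K : ℝ, 0 ≤ K ∧ ∀ (N : ℕ) (θ : ℝ), 1 ≤ N →
        N * (1 - Real.cos (n * θ)) ≤ K * ∑ i, cosDefect (s i) (t i) N θ}
      zero_mem' := ⟨0, le_rfl, fun N θ _ => by simp⟩
      neg_mem' := by
        rintro n ⟨K, hK, h⟩
        refine ⟨K, hK, fun N θ hN => ?_⟩
        simpa using h N θ hN
      add_mem' := by
        rintro m n ⟨K, hK, h⟩ ⟨L, hL, h'⟩
        refine ⟨2 * K + 2 * L, by positivity, fun N θ hN => ?_⟩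
        have h1 := one_sub_cos_sub_le (m * θ) (-(n * θ))
        rw [Real.cos_neg] at h1
        have e : ((m + n : ℤ) : ℝ) * θ = m * θ - -(n * θ) := by push_cast; ring
        have h2 := h N θ hN
        have h3 := h' N θ hN
        rw [e]
        calc _ ≤ (N : ℝ) * (2 * (1 - Real.cos (m * θ)) + 2 * (1 - Real.cos (n * θ))) := by gcongr
          _ ≤ _ := by linarith }
  have hs (i : ι) : (s i : ℤ) ∈ H := ⟨4, by norm_num, fun N θ hN => by
    have h1 := mul_one_sub_cos_modulus_le (s i) (t i) N θ hN
    rw [one_mul] at h1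
    have h2 := hle i N θ
    push_cast
    linarith⟩
  have ht (i : ι) : (t i : ℤ) ∈ H := ⟨10, by norm_num, fun N θ hN => by
    have h1 := mul_one_sub_cos_residue_le (s i) (t i) N θ
    have h2 := hle i N θ
    push_cast
    linarith⟩
  obtain ⟨d, hd⟩ := Int.subgroup_cyclic H
  rw [← AddSubgroup.zmultiples_eq_closure] at hd
  have h1 : d.natAbs = 1 := by
    refine hgcd _ fun i => ⟨?_, ?_⟩
    · have := hs i
      rw [hd, Int.mem_zmultiples_iff] at this
      exact Int.natAbs_dvd_natAbs.2 this
    · have := ht i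
      rw [hd, Int.mem_zmultiples_iff] at this
      exact Int.natAbs_dvd_natAbs.2 this
  have h2 : (1 : ℤ) ∈ H := by
    rw [hd, Int.mem_zmultiples_iff]
    exact Int.natAbs_dvd_natAbs.1 (by simp [h1])
  obtain ⟨K, hK, h⟩ := h2
  refine ⟨K + 1, by positivity, fun N θ hN => ?_⟩
  have := h N θ hN
  simp only [Int.cast_one, one_mul] at this
  linarith [hT N θ]

theorem exists_le_sum_cosDefect [Nonempty ι] (hs : ∀ i, 0 < s i)
    (hgcd : ∀ d : ℕ, (∀ i, d ∣ s i ∧ d ∣ t i) → d = 1) :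
    ∃ c : ℝ, 0 < c ∧ ∀ (N : ℕ) (θ : ℝ), 1 ≤ N → |θ| ≤ π →
      c * min (N : ℝ) ((N : ℝ) ^ 3 * θ ^ 2) ≤ ∑ i, cosDefect (s i) (t i) N θ := by
  obtain ⟨K, hK, hK'⟩ := exists_mul_one_sub_cos_le hgcd
  obtain ⟨i⟩ := (inferInstance : Nonempty ι)
  have hle (N : ℕ) (θ : ℝ) :
      cosDefect (s i) (t i) N θ ≤ ∑ i, cosDefect (s i) (t i) N θ :=
    Finset.single_le_sum (f := fun i => cosDefect (s i) (t i) N θ)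
      (fun i _ => cosDefect_nonneg _ _ _ _) (Finset.mem_univ i)
  obtain ⟨σ, hσ⟩ : ∃ σ : ℝ, σ = s i := ⟨_, rfl⟩
  have hσ1 : 1 ≤ σ := by rw [hσ]; exact_mod_cast hs i
  have hπ := pi_pos
  -- With `σ` one of the moduli, the three constants serve three ranges. For `σN|θ| ≤ π` the shift
  -- `j = N` gives the quadratic bound. For larger `θ` with `σ|θ| ≤ π`, take `j = ⌊π/(σ|θ|)⌋`, so
  -- that `jσ|θ|` lies in `[π/2, π]`. For `σ|θ| > π`, `θ` stays away from `0` and the gcd bound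
  -- applies.
  refine ⟨min (1 / (2 * π ^ 2)) (min (1 / 8) (2 / (σ ^ 2 * K))), by positivity,
    fun N θ hN hθ => ?_⟩
  have hN' : (1 : ℝ) ≤ N := by exact_mod_cast hN
  set c := min (1 / (2 * π ^ 2)) (min (1 / 8) (2 / (σ ^ 2 * K))) with hc
  have hc1 : c ≤ 1 / (2 * π ^ 2) := min_le_left _ _
  have hc2 : c ≤ 1 / 8 := (min_le_right _ _).trans (min_le_left _ _)
  have hc3 : c ≤ 2 / (σ ^ 2 * K) := (min_le_right _ _).trans (min_le_right _ _)
  have hc0 : 0 < c := by positivity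
  have hmod (j : ℕ) (hj : j ≤ N) (hjθ : |(j * s i : ℕ) * θ| ≤ π) :
      N * (2 / π ^ 2 * ((j * σ) * θ) ^ 2) ≤ 4 * ∑ i, cosDefect (s i) (t i) N θ := by
    have h1 := mul_one_sub_cos_modulus_le (s i) (t i) N θ hj
    have h2 := Real.cos_le_one_sub_mul_cos_sq hjθ
    have h3 := hle N θ
    have h4 : ((j * s i : ℕ) : ℝ) = j * σ := by rw [hσ]; push_cast; rfl
    rw [h4] at h1 h2
    calc _ ≤ (N : ℝ) * (1 - Real.cos (j * σ * θ)) := by gcongr; linarith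
      _ ≤ _ := by linarith
  rcases le_or_gt (σ * N * |θ|) π with h | h
  · have := hmod N le_rfl (by
      rw [abs_mul, abs_of_nonneg (by positivity)]
      push_cast
      rw [← hσ]; linarith)
    have h5 : 1 / (2 * π ^ 2) * ((N : ℝ) ^ 3 * θ ^ 2) * 4 ≤
        N * (2 / π ^ 2 * ((N * σ) * θ) ^ 2) := by
      have : N * (2 / π ^ 2 * ((N * σ) * θ) ^ 2) =
        1 / (2 * π ^ 2) * ((N : ℝ) ^ 3 * θ ^ 2) * 4 * σ ^ 2 := by field_simp; ring
      rw [this]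
      exact le_mul_of_one_le_right (by positivity) (one_le_pow₀ hσ1)
    calc _ ≤ 1 / (2 * π ^ 2) * ((N : ℝ) ^ 3 * θ ^ 2) := by gcongr; exact min_le_right _ _
      _ ≤ _ := by linarith
  refine (mul_le_mul_of_nonneg_left (min_le_left _ _) hc0.le).trans ?_
  have hθ0 : 0 < |θ| := by
    by_contra h0
    have : |θ| = 0 := le_antisymm (not_lt.1 h0) (abs_nonneg _)
    rw [this] at h; linarith
  rcases le_or_gt (σ * |θ|) π with h' | h'
  · set j := ⌊π / (σ * |θ|)⌋₊ with hj
    have hq : 0 < σ * |θ| := by positivity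
    have hj1 : (j : ℝ) * (σ * |θ|) ≤ π := by
      rw [← le_div_iff₀ hq]; exact Nat.floor_le (by positivity)
    have hj2 : π < ((j : ℝ) + 1) * (σ * |θ|) := by
      rw [← div_lt_iff₀ hq]; exact Nat.lt_floor_add_one _
    have hj3 : (1 : ℝ) ≤ j := by
      have : 1 ≤ j := Nat.le_floor (by rw [Nat.cast_one, le_div_iff₀ hq]; linarith)
      exact_mod_cast this
    have hjN : j ≤ N := by
      have : (j : ℝ) ≤ N := by
        by_contra hcon
        have : (N : ℝ) * (σ * |θ|) ≤ j * (σ * |θ|) :=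
          mul_le_mul_of_nonneg_right (not_le.1 hcon).le hq.le
        linarith
      exact_mod_cast this
    have := hmod j hjN (by
      rw [abs_mul, abs_of_nonneg (by positivity)]
      push_cast
      rw [← hσ]; linarith)
    have hj4 : π / 2 ≤ j * (σ * |θ|) := by nlinarith
    have hj5 : (π / 2) ^ 2 ≤ ((j * σ) * θ) ^ 2 := by
      rw [← sq_abs (j * σ * θ), abs_mul, abs_of_nonneg (by positivity : 0 ≤ (j : ℝ) * σ), mul_assoc]
      gcongr
    have hj6 : (N : ℝ) * (2 / π ^ 2 * (π / 2) ^ 2) ≤ N * (2 / π ^ 2 * ((j * σ) * θ) ^ 2) := by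
      gcongr
    have hj7 : (N : ℝ) * (2 / π ^ 2 * (π / 2) ^ 2) = N / 2 := by field_simp
    calc _ ≤ 1 / 8 * (N : ℝ) := by gcongr
      _ ≤ _ := by linarith
  · have h1 := hK' N θ hN
    have h2 := Real.cos_le_one_sub_mul_cos_sq hθ
    have h3 : (π / σ) ^ 2 ≤ θ ^ 2 := by
      rw [← sq_abs θ]
      have : π / σ ≤ |θ| := by rw [div_le_iff₀ (by positivity)]; linarith
      gcongr
    have h4 : 2 / σ ^ 2 ≤ 1 - Real.cos θ := by
      calc 2 / σ ^ 2 = 2 / π ^ 2 * (π / σ) ^ 2 := by field_simp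
        _ ≤ 2 / π ^ 2 * θ ^ 2 := by gcongr
        _ ≤ _ := by linarith
    calc _ ≤ 2 / (σ ^ 2 * K) * (N : ℝ) := by gcongr
      _ = N * (2 / σ ^ 2) / K := by field_simp
      _ ≤ N * (1 - Real.cos θ) / K := by gcongr
      _ ≤ _ := by rw [div_le_iff₀' hK]; exact h1

/-- Only the indices `k < 2⌊1/x⌋` are used: there the exponential weights are at least `e^{-S}`, and
the unweighted bound with `N = ⌊1/x⌋` applies. The `8` comes from `(1/x)³ ≤ (2N)³`. -/
theorem exists_min_le_sum_exp_mul_one_sub_cos [Nonempty ι] (hs : ∀ i, 0 < s i)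
    (hgcd : ∀ d : ℕ, (∀ i, d ∣ s i ∧ d ∣ t i) → d = 1) :
    ∃ c : ℝ, 0 < c ∧ ∀ x θ : ℝ, 0 < x → x ≤ 1 → |θ| ≤ π → ∃ N : ℕ, ∀ M, N ≤ M →
      c * min (1 / x) (θ ^ 2 / x ^ 3) ≤ ∑ k ∈ Finset.range M, ∑ i,
        Real.exp (-(x * (s i * k + t i : ℕ))) * (1 - Real.cos ((s i * k + t i : ℕ) * θ)) := by
  obtain ⟨c, hc, h⟩ := exists_le_sum_cosDefect hs hgcd
  set S : ℝ := ∑ i, ((2 * s i + t i : ℕ) : ℝ) with hS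
  refine ⟨Real.exp (-S) * (c / 8), by positivity,
    fun x θ hx hx1 hθ => ⟨2 * ⌊1 / x⌋₊, fun M hM => ?_⟩⟩
  set N := ⌊1 / x⌋₊ with hN
  have hN1 : 1 ≤ N := Nat.le_floor (by rw [Nat.cast_one, le_div_iff₀ hx]; linarith)
  have hN1' : (1 : ℝ) ≤ N := by exact_mod_cast hN1
  have hN2 : (N : ℝ) ≤ 1 / x := Nat.floor_le (by positivity)
  have hN3 : 1 / x ≤ 2 * N := by
    have := Nat.lt_floor_add_one (1 / x)
    linarith
  have hterm (i : ι) (k : ℕ) (hk : k ∈ Finset.range (2 * N)) :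
      Real.exp (-S) * (1 - Real.cos ((s i * k + t i : ℕ) * θ)) ≤
        Real.exp (-(x * (s i * k + t i : ℕ))) * (1 - Real.cos ((s i * k + t i : ℕ) * θ)) := by
    refine mul_le_mul_of_nonneg_right (Real.exp_le_exp.2 (neg_le_neg ?_)) (one_sub_cos_nonneg _)
    have h1 : ((2 * s i + t i : ℕ) : ℝ) ≤ S :=
      Finset.single_le_sum (f := fun i => ((2 * s i + t i : ℕ) : ℝ))
        (fun i _ => by positivity) (Finset.mem_univ i)
    refine le_trans ?_ h1
    have h2 : (k : ℝ) ≤ 2 * N := by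
      have := (Finset.mem_range.1 hk).le
      exact_mod_cast this
    have h3 : x * N ≤ 1 := by rw [le_div_iff₀ hx] at hN2; linarith
    push_cast
    calc x * (s i * k + t i) = s i * (x * k) + x * t i := by ring
      _ ≤ s i * (x * (2 * N)) + 1 * t i := by gcongr
      _ = s i * (2 * (x * N)) + t i := by ring
      _ ≤ s i * (2 * 1) + t i := by gcongr
      _ = _ := by ring
  calc Real.exp (-S) * (c / 8) * min (1 / x) (θ ^ 2 / x ^ 3)
      ≤ Real.exp (-S) * (c * min (N : ℝ) ((N : ℝ) ^ 3 * θ ^ 2)) := by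
        have : min (1 / x) (θ ^ 2 / x ^ 3) ≤ 8 * min (N : ℝ) ((N : ℝ) ^ 3 * θ ^ 2) := by
          rw [mul_min_of_nonneg _ _ (by norm_num)]
          refine min_le_min (by linarith) ?_
          calc θ ^ 2 / x ^ 3 = (1 / x) ^ 3 * θ ^ 2 := by field_simp
            _ ≤ (2 * N) ^ 3 * θ ^ 2 := by gcongr
            _ = _ := by ring
        calc _ ≤ Real.exp (-S) * (c / 8) * (8 * min (N : ℝ) ((N : ℝ) ^ 3 * θ ^ 2)) := by gcongr
          _ = _ := by ring
    _ ≤ Real.exp (-S) * ∑ i, cosDefect (s i) (t i) N θ := by gcongr; exact h N θ hN1 hθ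
    _ ≤ ∑ i, ∑ k ∈ Finset.range (2 * N), Real.exp (-(x * (s i * k + t i : ℕ))) *
          (1 - Real.cos ((s i * k + t i : ℕ) * θ)) := by
        rw [Finset.mul_sum]
        refine Finset.sum_le_sum fun i _ => ?_
        rw [cosDefect, Finset.mul_sum]
        exact Finset.sum_le_sum fun k hk => hterm i k hk
    _ = ∑ k ∈ Finset.range (2 * N), ∑ i, Real.exp (-(x * (s i * k + t i : ℕ))) *
          (1 - Real.cos ((s i * k + t i : ℕ) * θ)) := Finset.sum_comm
    _ ≤ _ := Finset.sum_le_sum_of_subset_of_nonneg (Finset.range_mono hM) fun _ _ _ =>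
        Finset.sum_nonneg fun _ _ => mul_nonneg (Real.exp_pos _).le (one_sub_cos_nonneg _)

end Family

/-! ### Bounds for single factors -/

theorem sq_norm_one_sub_polar (r α : ℝ) :
    ‖(1 : ℂ) - r * Complex.exp (α * Complex.I)‖ ^ 2 = (1 - r) ^ 2 + 2 * r * (1 - Real.cos α) := by
  rw [← Complex.normSq_eq_norm_sq, Complex.normSq_apply]
  simp only [Complex.sub_re, Complex.one_re, Complex.mul_re, Complex.ofReal_re, Complex.ofReal_im,
    Complex.exp_ofReal_mul_I_re, Complex.exp_ofReal_mul_I_im, Complex.sub_im, Complex.one_im,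
    Complex.mul_im]
  linear_combination r ^ 2 * Real.sin_sq_add_cos_sq α

theorem norm_inv_one_sub_polar_le {r α : ℝ} (hr0 : 0 < r) (hr1 : r < 1) :
    ‖((1 : ℂ) - r * Complex.exp (α * Complex.I))⁻¹‖ ≤
      (1 - r)⁻¹ * Real.exp (-(1 / 5 * (r * (1 - Real.cos α)))) := by
  have h := sq_norm_one_sub_polar r α
  have hv0 := one_sub_cos_nonneg α
  have hv2 : 1 - Real.cos α ≤ 2 := by linarith [Real.neg_one_le_cos α]
  set v := 1 - Real.cos α
  have hrv : 0 ≤ r * v := by positivity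
  have hrv2 : r * v ≤ 2 := by nlinarith
  have hq : 0 < 1 - r := by linarith
  rw [Real.exp_neg, ← mul_inv, norm_inv]
  refine inv_anti₀ (by positivity) ((sq_le_sq₀ (by positivity) (norm_nonneg _)).1 ?_)
  rw [h, mul_pow, ← Real.exp_nat_mul]
  -- With `w = rv` and `y = 2w/5`, `e^y ≤ 1/(1-y)`, and `(1-y)(1+2w) ≥ 1` holds exactly because `0 ≤
  -- w ≤ 2`; this dictates the constant `1/5`.
  have he : Real.exp ((2 : ℕ) * (1 / 5 * (r * v))) ≤ 1 + 2 * (r * v) := by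
    set y := (2 : ℕ) * (1 / 5 * (r * v)) with hy
    have hy' : y = 2 / 5 * (r * v) := by rw [hy]; push_cast; ring
    have h1 := Real.one_sub_le_exp_neg y
    rw [Real.exp_neg] at h1
    have hpos := Real.exp_pos y
    have h2 : (1 - y) * Real.exp y ≤ 1 := by
      calc _ ≤ (Real.exp y)⁻¹ * Real.exp y := by gcongr
        _ = 1 := inv_mul_cancel₀ hpos.ne'
    have h3 : 1 ≤ (1 - y) * (1 + 2 * (r * v)) := by nlinarith
    have h4 : 0 < 1 - y := by linarith
    exact le_of_mul_le_mul_left (h2.trans h3) h4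
  have hq1 : (1 - r) ^ 2 ≤ 1 := pow_le_one₀ hq.le (by linarith)
  calc _ ≤ (1 - r) ^ 2 * (1 + 2 * (r * v)) := by gcongr
    _ ≤ _ := by nlinarith

theorem norm_one_add_polar_le {r α : ℝ} (hr0 : 0 < r) (hr1 : r < 1) :
    ‖(1 : ℂ) + r * Complex.exp (α * Complex.I)‖ ≤
      (1 + r) * Real.exp (-(1 / 5 * (r * (1 - Real.cos α)))) := by
  have h := sq_norm_one_sub_polar (-r) α
  rw [show (1 : ℂ) - ((-r : ℝ) : ℂ) * Complex.exp (α * Complex.I) =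
    1 + r * Complex.exp (α * Complex.I) by push_cast; ring] at h
  have hv0 := one_sub_cos_nonneg α
  set v := 1 - Real.cos α
  have hrv : 0 ≤ r * v := by positivity
  refine (sq_le_sq₀ (norm_nonneg _) (by positivity)).1 ?_
  rw [h, mul_pow, ← Real.exp_nat_mul]
  have h1 := Real.one_sub_le_exp_neg (2 / 5 * (r * v))
  rw [show ((2 : ℕ) : ℝ) * -(1 / 5 * (r * v)) = -(2 / 5 * (r * v)) by push_cast; ring]
  calc _ ≤ (1 + r) ^ 2 * (1 - 2 / 5 * (r * v)) := by
        nlinarith [mul_nonneg hrv (by nlinarith : (0 : ℝ) ≤ 4 - (1 + r) ^ 2)]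
    _ ≤ _ := by gcongr

/-! ### Evaluation of real power series at complex numbers -/

/-- The series `∑ coeff n p * zⁿ` converges absolutely, with sum `v`. -/
def HasAbsSum (p : ℝ⟦X⟧) (z v : ℂ) : Prop :=
  Summable (fun n => ‖((coeff n p : ℝ) : ℂ) * z ^ n‖) ∧
    HasSum (fun n => ((coeff n p : ℝ) : ℂ) * z ^ n) v

theorem HasAbsSum.mul {p q : ℝ⟦X⟧} {z v w : ℂ} (hp : HasAbsSum p z v) (hq : HasAbsSum q z w) :
    HasAbsSum (p * q) z (v * w) := by
  have heq (n : ℕ) : ((coeff n (p * q) : ℝ) : ℂ) * z ^ n =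
      ∑ kl ∈ Finset.HasAntidiagonal.antidiagonal n,
        (((coeff kl.1 p : ℝ) : ℂ) * z ^ kl.1) * (((coeff kl.2 q : ℝ) : ℂ) * z ^ kl.2) := by
    rw [coeff_mul]
    push_cast
    rw [Finset.sum_mul]
    refine Finset.sum_congr rfl fun kl hkl => ?_
    rw [← Finset.HasAntidiagonal.mem_antidiagonal.1 hkl, pow_add]
    ring
  have h1 := summable_norm_sum_mul_antidiagonal_of_summable_norm hp.1 hq.1
  have h2 := tsum_mul_tsum_eq_tsum_sum_antidiagonal_of_summable_norm hp.1 hq.1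
  refine ⟨h1.congr fun n => by rw [heq], ?_⟩
  simp_rw [heq]
  rw [← hp.2.tsum_eq, ← hq.2.tsum_eq, h2]
  exact h1.of_norm.hasSum

theorem HasAbsSum.one (z : ℂ) : HasAbsSum 1 z 1 := by
  have h : ∀ n, n ≠ 0 → ((coeff n (1 : ℝ⟦X⟧) : ℝ) : ℂ) * z ^ n = 0 := fun n hn => by
    simp [coeff_one, hn]
  constructor
  · exact summable_of_ne_finset_zero (s := {0}) fun n hn => by
      rw [h n (by simpa using hn), norm_zero]
  · have := hasSum_single (f := fun n => ((coeff n (1 : ℝ⟦X⟧) : ℝ) : ℂ) * z ^ n) 0 h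
    simpa using this

theorem HasAbsSum.prod {κ : Type*} {S : Finset κ} {p : κ → ℝ⟦X⟧} {z : ℂ} {v : κ → ℂ}
    (h : ∀ i ∈ S, HasAbsSum (p i) z (v i)) : HasAbsSum (∏ i ∈ S, p i) z (∏ i ∈ S, v i) := by
  classical
  induction S using Finset.induction_on with
  | empty => simpa using HasAbsSum.one z
  | insert i S hi ih =>
    rw [Finset.prod_insert hi, Finset.prod_insert hi]
    exact (h i (Finset.mem_insert_self i S)).mul
      (ih fun j hj => h j (Finset.mem_insert_of_mem hj))

theorem coeff_mul_nonneg {p q : ℝ⟦X⟧} (hp : ∀ n, 0 ≤ coeff n p) (hq : ∀ n, 0 ≤ coeff n q) (n : ℕ) :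
    0 ≤ coeff n (p * q) := by
  rw [coeff_mul]
  exact Finset.sum_nonneg fun kl _ => mul_nonneg (hp _) (hq _)

theorem coeff_prod_nonneg {κ : Type*} {S : Finset κ} {p : κ → ℝ⟦X⟧}
    (h : ∀ i ∈ S, ∀ n, 0 ≤ coeff n (p i)) (n : ℕ) : 0 ≤ coeff n (∏ i ∈ S, p i) := by
  classical
  induction S using Finset.induction_on generalizing n with
  | empty => rw [Finset.prod_empty, coeff_one]; split_ifs <;> norm_num
  | insert i S hi ih =>
    rw [Finset.prod_insert hi]
    exact coeff_mul_nonneg (h i (Finset.mem_insert_self i S))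
      (ih fun j hj => h j (Finset.mem_insert_of_mem hj)) n

theorem dvd_prod_sub_one {R κ : Type*} [CommRing R] {S : Finset κ} {d : R} {p : κ → R}
    (h : ∀ i ∈ S, d ∣ p i - 1) : d ∣ ∏ i ∈ S, p i - 1 := by
  classical
  induction S using Finset.induction_on with
  | empty => simp
  | insert i S hi ih =>
    rw [Finset.prod_insert hi]
    have h1 := h i (Finset.mem_insert_self i S)
    have h2 := ih fun j hj => h j (Finset.mem_insert_of_mem hj)
    have : p i * ∏ j ∈ S, p j - 1 = (p i - 1) * ∏ j ∈ S, p j + (∏ j ∈ S, p j - 1) := by ring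
    rw [this]
    exact dvd_add (h1.mul_right _) h2

/-! ### Infinite products with nonnegative coefficients -/

/-- Each factor has constant term `1` and nonnegative coefficients, so the coefficients of the
partial products increase to their limits. The limit series therefore dominates every partial
product. -/
theorem exists_hasProd_of_dvd_sub_one {f : ℕ → ℝ⟦X⟧} (h0 : ∀ k n, 0 ≤ coeff n (f k))
    (h1 : ∀ k, (X : ℝ⟦X⟧) ^ (k + 1) ∣ f k - 1) :
    ∃ g : ℝ⟦X⟧, HasProd f g ∧
      (∀ K n, coeff n (∏ k ∈ Finset.range K, f k) ≤ coeff n g) ∧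
      ∀ n, Tendsto (fun K => coeff n (∏ k ∈ Finset.range K, f k)) atTop (𝓝 (coeff n g)) := by
  have hm : Multipliable fun k => 1 + (f k - 1) := by
    refine PowerSeries.WithPiTopology.multipliable_one_add_of_tendsto_order_atTop_nhds_top ℝ ?_
    refine ENat.tendsto_nhds_top_iff_natCast_lt.mpr fun n =>
      eventually_atTop.mpr ⟨n, fun k hk => ?_⟩
    have h2 : ((k + 1 : ℕ) : ℕ∞) ≤ (f k - 1).order := by
      exact nat_le_order _ _ fun i hi => (X_pow_dvd_iff.1 (h1 k)) i hi
    refine lt_of_lt_of_le ?_ h2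
    exact_mod_cast Nat.lt_succ_of_le hk
  simp only [add_sub_cancel] at hm
  obtain ⟨g, hg⟩ := hm
  have hlim (n : ℕ) :
      Tendsto (fun K => coeff n (∏ k ∈ Finset.range K, f k)) atTop (𝓝 (coeff n g)) :=
    ((PowerSeries.WithPiTopology.continuous_coeff ℝ n).tendsto g).comp hg.tendsto_prod_nat
  refine ⟨g, hg, fun K n => ?_, hlim⟩
  have hmono : Monotone fun K => coeff n (∏ k ∈ Finset.range K, f k) := by
    refine monotone_nat_of_le_succ fun K => ?_
    rw [Finset.prod_range_succ, coeff_mul]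
    have hc : coeff 0 (f K) = 1 := by
      have := X_pow_dvd_iff.1 (h1 K) 0 (Nat.succ_pos K)
      rw [map_sub, coeff_zero_one, sub_eq_zero] at this
      exact this
    have hle := Finset.single_le_sum (s := Finset.HasAntidiagonal.antidiagonal n)
      (f := fun kl => coeff kl.1 (∏ k ∈ Finset.range K, f k) * coeff kl.2 (f K))
      (fun kl _ => mul_nonneg (coeff_prod_nonneg (fun i _ => h0 i) _) (h0 _ _))
      (a := (n, 0)) (by simp)
    simpa only [hc, mul_one] using hle
  exact hmono.ge_of_tendsto (hlim n) K

theorem summable_coeff_of_prod_le {f : ℕ → ℝ⟦X⟧} {g : ℝ⟦X⟧} (h0 : ∀ k n, 0 ≤ coeff n (f k))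
    (hlim : ∀ n, Tendsto (fun K => coeff n (∏ k ∈ Finset.range K, f k)) atTop (𝓝 (coeff n g)))
    (hle : ∀ K n, coeff n (∏ k ∈ Finset.range K, f k) ≤ coeff n g)
    {r M : ℝ} (hr : 0 ≤ r) {E : ℕ → ℝ} (hE : ∀ k, HasAbsSum (f k) r (E k))
    (hM : ∀ K, ∏ k ∈ Finset.range K, E k ≤ M) : Summable fun n => coeff n g * r ^ n := by
  have hg0 (n : ℕ) : 0 ≤ coeff n g := (coeff_prod_nonneg (fun i _ => h0 i) n).trans (hle 0 n)
  refine summable_of_sum_le (c := M) (fun n => mul_nonneg (hg0 n) (pow_nonneg hr n)) fun u => ?_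
  have hl : Tendsto (fun K => ∑ n ∈ u, coeff n (∏ k ∈ Finset.range K, f k) * r ^ n) atTop
      (𝓝 (∑ n ∈ u, coeff n g * r ^ n)) :=
    tendsto_finsetSum _ fun n _ => (hlim n).mul_const _
  refine le_of_tendsto' hl fun K => ?_
  have hs := (HasAbsSum.prod (S := Finset.range K) fun k _ => hE k).2
  have hs' : HasSum (fun n => coeff n (∏ k ∈ Finset.range K, f k) * r ^ n)
      (∏ k ∈ Finset.range K, E k) := by
    rw [← Complex.hasSum_ofReal]
    push_cast
    exact hs
  exact (sum_le_hasSum u (fun n _ => mul_nonneg (coeff_prod_nonneg (fun i _ => h0 i) n)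
    (pow_nonneg hr n)) hs').trans (hM K)

/-- Dominated convergence with the coefficients of `g` as majorant: formal convergence becomes
convergence of values at complex points. -/
theorem tendsto_prod_of_summable_coeff {f : ℕ → ℝ⟦X⟧} {g : ℝ⟦X⟧} (h0 : ∀ k n, 0 ≤ coeff n (f k))
    (hlim : ∀ n, Tendsto (fun K => coeff n (∏ k ∈ Finset.range K, f k)) atTop (𝓝 (coeff n g)))
    (hle : ∀ K n, coeff n (∏ k ∈ Finset.range K, f k) ≤ coeff n g)
    {z : ℂ} (hs : Summable fun n => coeff n g * ‖z‖ ^ n) {E : ℕ → ℂ}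
    (hE : ∀ k, HasAbsSum (f k) z (E k)) :
    Tendsto (fun K => ∏ k ∈ Finset.range K, E k) atTop
      (𝓝 (∑' n, ((coeff n g : ℝ) : ℂ) * z ^ n)) := by
  have h := tendsto_tsum_of_dominated_convergence (𝓕 := atTop)
    (f := fun K n => ((coeff n (∏ k ∈ Finset.range K, f k) : ℝ) : ℂ) * z ^ n)
    (g := fun n => ((coeff n g : ℝ) : ℂ) * z ^ n) hs
    (fun n => ((Complex.continuous_ofReal.tendsto _).comp (hlim n)).mul_const _)
    (Eventually.of_forall fun K n => by
      rw [norm_mul, norm_pow, Complex.norm_real,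
        Real.norm_of_nonneg (coeff_prod_nonneg (fun i _ => h0 i) n)]
      gcongr
      exact hle K n)
  refine h.congr fun K => ?_
  exact (HasAbsSum.prod (S := Finset.range K) fun k _ => hE k).2.tsum_eq

/-! ### The factors `1/(1-q^N)` and `1+q^N` -/

/-- `1/(1-X^N)` if `e` is true, `1+X^N` otherwise. -/
noncomputable def prodFactor (e : Bool) (N : ℕ) : ℝ⟦X⟧ :=
  if e then (1 - X ^ N)⁻¹ else 1 + X ^ N

/-- `1/(1-w)` if `e` is true, `1+w` otherwise. -/
noncomputable def prodFactorVal (e : Bool) (w : ℂ) : ℂ :=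
  if e then (1 - w)⁻¹ else 1 + w

theorem constantCoeff_one_sub_X_pow_ne_zero {N : ℕ} (hN : 0 < N) :
    constantCoeff (1 - X ^ N : ℝ⟦X⟧) ≠ 0 := by
  simp [hN.ne']

theorem inv_one_sub_X_pow {N : ℕ} (hN : 0 < N) :
    (1 - X ^ N : ℝ⟦X⟧)⁻¹ = mk fun n => if N ∣ n then 1 else 0 := by
  rw [eq_comm, PowerSeries.eq_inv_iff_mul_eq_one (constantCoeff_one_sub_X_pow_ne_zero hN)]
  ext n
  rw [mul_sub, mul_one, map_sub, coeff_mul_X_pow', coeff_mk, coeff_one, coeff_mk]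
  rcases lt_or_ge n N with h | h
  · rw [if_neg (not_le.2 h), sub_zero]
    refine if_congr ⟨fun hd => ?_, fun h0 => h0 ▸ dvd_zero N⟩ rfl rfl
    exact Nat.eq_zero_of_dvd_of_lt hd h
  · rw [if_pos h, if_neg (by omega : n ≠ 0)]
    rw [if_congr (Nat.dvd_sub_iff_left h dvd_rfl) rfl rfl, sub_self]

theorem coeff_prodFactor_nonneg (e : Bool) {N : ℕ} (hN : 0 < N) (n : ℕ) :
    0 ≤ coeff n (prodFactor e N) := by
  unfold prodFactor
  split_ifs
  · rw [inv_one_sub_X_pow hN, coeff_mk]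
    split_ifs <;> norm_num
  · rw [map_add, coeff_one, coeff_X_pow]
    split_ifs <;> norm_num

theorem X_pow_dvd_prodFactor_sub_one (e : Bool) {N : ℕ} (hN : 0 < N) :
    (X : ℝ⟦X⟧) ^ N ∣ prodFactor e N - 1 := by
  unfold prodFactor
  split_ifs
  · refine ⟨(1 - X ^ N)⁻¹, ?_⟩
    have := PowerSeries.mul_inv_cancel _ (constantCoeff_one_sub_X_pow_ne_zero hN)
    linear_combination this
  · simp

theorem hasAbsSum_prodFactor (e : Bool) {N : ℕ} (hN : 0 < N) {z : ℂ} (hz : ‖z‖ < 1) :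
    HasAbsSum (prodFactor e N) z (prodFactorVal e (z ^ N)) := by
  unfold prodFactor prodFactorVal
  split_ifs
  · rw [inv_one_sub_X_pow hN]
    simp only [HasAbsSum, coeff_mk]
    have hinj : Function.Injective fun k : ℕ => N * k := fun a b h => by
      simpa [hN.ne'] using h
    have hout (n : ℕ) (hn : n ∉ Set.range fun k : ℕ => N * k) : ¬N ∣ n := by
      rintro ⟨k, rfl⟩
      exact hn ⟨k, rfl⟩
    have hw : ‖z ^ N‖ < 1 := by
      rw [norm_pow]; exact pow_lt_one₀ (norm_nonneg z) hz hN.ne'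
    constructor
    · rw [← hinj.summable_iff]
      · refine (summable_geometric_of_lt_one (norm_nonneg _) hw).congr fun k => ?_
        simp [pow_mul]
      · intro n hn
        simp [hout n hn]
    · rw [← hinj.hasSum_iff]
      · refine (hasSum_geometric_of_norm_lt_one hw).congr_fun fun k => ?_
        simp [pow_mul]
      · intro n hn
        simp [hout n hn]
  · have hc (n : ℕ) : ((coeff n (1 + X ^ N : ℝ⟦X⟧) : ℝ) : ℂ) * z ^ n =
        (if n = 0 then 1 else 0) + (if n = N then z ^ N else 0) := by
      rw [map_add, coeff_one, coeff_X_pow]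
      push_cast
      rw [add_mul]
      congr 1
      · split_ifs with h <;> simp [h]
      · split_ifs with h <;> simp [h]
    simp only [HasAbsSum, hc]
    constructor
    · refine summable_of_ne_finset_zero (s := {0, N}) fun n hn => ?_
      simp only [Finset.mem_insert, Finset.mem_singleton, not_or] at hn
      simp [hn.1, hn.2]
    · exact (hasSum_ite_eq 0 1).add (hasSum_ite_eq N (z ^ N))

/-- `log` of `prodFactorVal e (e^{-y})`. -/
noncomputable def logFactor (e : Bool) (y : ℝ) : ℝ :=
  if e then negLogOneSubExp y else negLogOneSubExp y - negLogOneSubExp (2 * y)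

theorem prodFactorVal_exp (e : Bool) {y : ℝ} (hy : 0 < y) :
    prodFactorVal e (Real.exp (-y) : ℝ) = (Real.exp (logFactor e y) : ℝ) := by
  unfold prodFactorVal logFactor
  split_ifs
  · rw [exp_negLogOneSubExp hy]; push_cast; rfl
  · rw [Real.exp_sub, exp_negLogOneSubExp hy, exp_negLogOneSubExp (by linarith)]
    have h1 := one_sub_exp_neg_pos hy
    have h2 : Real.exp (-(2 * y)) = Real.exp (-y) ^ 2 := by
      rw [← Real.exp_nat_mul]; congr 1; push_cast; ring
    have h3 : (1 - Real.exp (-y))⁻¹ / (1 - Real.exp (-(2 * y)))⁻¹ = 1 + Real.exp (-y) := by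
      have h4 : 0 < 1 + Real.exp (-y) := by positivity
      have h5 : 1 - Real.exp (-(2 * y)) = (1 - Real.exp (-y)) * (1 + Real.exp (-y)) := by
        rw [h2]; ring
      rw [h5]
      field_simp
    rw [h3]; push_cast; rfl

theorem norm_prodFactorVal_le (e : Bool) {y : ℝ} (hy : 0 < y) (α : ℝ) :
    ‖prodFactorVal e (Complex.exp (-y + α * Complex.I))‖ ≤ Real.exp (logFactor e y) *
      Real.exp (-(1 / 5 * (Real.exp (-y) * (1 - Real.cos α)))) := by
  have hr0 := Real.exp_pos (-y)
  have hr1 : Real.exp (-y) < 1 := Real.exp_lt_one_iff.2 (by linarith)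
  have hv : Real.exp (logFactor e y) = ‖prodFactorVal e (Real.exp (-y) : ℝ)‖ := by
    rw [prodFactorVal_exp e hy, Complex.norm_real, Real.norm_of_nonneg (Real.exp_pos _).le]
  have hz : Complex.exp (-y + α * Complex.I) =
      (Real.exp (-y) : ℝ) * Complex.exp (α * Complex.I) := by
    rw [Complex.exp_add]; push_cast; rfl
  rw [hv, hz]
  unfold prodFactorVal
  split_ifs
  · refine (norm_inv_one_sub_polar_le hr0 hr1).trans (le_of_eq ?_)
    rw [norm_inv, ← Complex.ofReal_one, ← Complex.ofReal_sub, Complex.norm_real,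
      Real.norm_of_nonneg (by linarith)]
  · refine (norm_one_add_polar_le hr0 hr1).trans (le_of_eq ?_)
    rw [← Complex.ofReal_one, ← Complex.ofReal_add, Complex.norm_real,
      Real.norm_of_nonneg (by linarith)]

/-! ### Products over finitely many arithmetic progressions -/

/-- The coefficient of `1/x` in `log ∏ₖ (factor at e^{-x(sk+t)})`. -/
noncomputable def polarCoeff (e : Bool) (s : ℝ) : ℝ :=
  if e then π ^ 2 / 6 / s else π ^ 2 / 12 / s

/-- The coefficient of `-log x` in `log ∏ₖ (factor at e^{-x(sk+t)})`. -/
noncomputable def logCoeff (e : Bool) (s t : ℝ) : ℝ :=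
  if e then 1 / 2 - t / s else 0

/-- The constant term of `log ∏ₖ (factor at e^{-x(sk+t)})`. -/
noncomputable def constCoeffLog (e : Bool) (s t : ℝ) : ℝ :=
  if e then Real.log (Real.Gamma (t / s)) - Real.log (2 * π) / 2 - (1 / 2 - t / s) * Real.log s
  else (1 / 2 - t / s) * Real.log 2

theorem polarCoeff_pos (e : Bool) {s : ℝ} (hs : 0 < s) : 0 < polarCoeff e s := by
  have := pi_pos
  unfold polarCoeff
  split_ifs <;> positivity

/-- `∑ₖ logFactor e (x(sk+t))`. -/
noncomputable def logProduct (e : Bool) (s t x : ℝ) : ℝ :=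
  if e then logQPoch (t / s) (s * x) else logQPoch (t / s) (s * x) - logQPoch (t / s) (2 * s * x)

theorem hasSum_logFactor (e : Bool) {s t x : ℝ} (hs : 0 < s) (ht : 0 < t) (hx : 0 < x) :
    HasSum (fun k : ℕ => logFactor e (x * (s * k + t))) (logProduct e s t x) := by
  have h1 := (summable_negLogOneSubExp (div_pos ht hs) (mul_pos hs hx)).hasSum
  have h2 := (summable_negLogOneSubExp (div_pos ht hs) (mul_pos (mul_pos two_pos hs) hx)).hasSum
  have e1 (k : ℕ) : s * x * (k + t / s) = x * (s * k + t) := by field_simp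
  have e2 (k : ℕ) : 2 * s * x * (k + t / s) = 2 * (x * (s * k + t)) := by field_simp
  simp only [e1] at h1
  simp only [e2] at h2
  unfold logFactor logProduct
  cases e
  · simp only [Bool.false_eq_true, if_false]
    have h3 := h1.sub h2
    unfold logQPoch
    simpa only [e1, e2] using h3
  · simp only [if_true]
    unfold logQPoch
    simpa only [e1] using h1

/-- For `1+q^N`, subtracting the expansion at `2x` from that at `x` halves the polar term and
cancels both `log x` and the Gamma constant, leaving `(1/2 - t/s) log 2`. -/
theorem tendsto_logProduct (e : Bool) {s t : ℝ} (hs : 0 < s) (ht : 0 < t) :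
    Tendsto (fun x => logProduct e s t x - (polarCoeff e s / x - logCoeff e s t * Real.log x))
      (𝓝[>] 0) (𝓝 (constCoeffLog e s t)) := by
  have h1 := (tendsto_logQPoch (div_pos ht hs)).comp (tendsto_const_mul_nhdsGT_zero hs)
  have h2 := (tendsto_logQPoch (div_pos ht hs)).comp
    (tendsto_const_mul_nhdsGT_zero (mul_pos two_pos hs))
  unfold logProduct polarCoeff logCoeff constCoeffLog
  cases e
  · simp only [Bool.false_eq_true, if_false]
    have h3 := (h1.sub h2).add_const ((1 / 2 - t / s) * Real.log 2)
    rw [sub_self, zero_add] at h3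
    refine h3.congr' ?_
    filter_upwards [self_mem_nhdsWithin] with x (hx : 0 < x)
    simp only [Function.comp]
    rw [mul_assoc 2 s x, Real.log_mul two_ne_zero (by positivity)]
    field_simp
    ring
  · simp only [if_true]
    have h3 := h1.sub_const ((1 / 2 - t / s) * Real.log s)
    refine h3.congr' ?_
    filter_upwards [self_mem_nhdsWithin] with x (hx : 0 < x)
    simp only [Function.comp]
    rw [Real.log_mul hs.ne' hx.ne']
    field_simp
    ring

section General

variable {ι : Type*} [Fintype ι] (s t : ι → ℕ) (e : ι → Bool)

theorem tendsto_exp_sum_logProduct (hs : ∀ i, 0 < s i) (ht : ∀ i, 0 < t i) :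
    Tendsto (fun x => Real.exp (∑ i, logProduct (e i) (s i) (t i) x) /
      (Real.exp (∑ i, constCoeffLog (e i) (s i) (t i)) *
        x ^ (-(∑ i, logCoeff (e i) (s i) (t i))) *
        Real.exp ((∑ i, polarCoeff (e i) (s i)) / x))) (𝓝[>] 0) (𝓝 1) := by
  have h1 : Tendsto (fun x => ∑ i, (logProduct (e i) (s i) (t i) x -
      (polarCoeff (e i) (s i) / x - logCoeff (e i) (s i) (t i) * Real.log x))) (𝓝[>] 0)
      (𝓝 (∑ i, constCoeffLog (e i) (s i) (t i))) :=
    tendsto_finsetSum _ fun i _ =>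
      tendsto_logProduct (e i) (by exact_mod_cast hs i) (by exact_mod_cast ht i)
  have h2 := (Real.continuous_exp.tendsto _).comp
    (h1.sub_const (∑ i, constCoeffLog (e i) (s i) (t i)))
  rw [sub_self, Real.exp_zero] at h2
  refine h2.congr' ?_
  filter_upwards [self_mem_nhdsWithin] with x (hx : 0 < x)
  simp only [Function.comp]
  rw [Real.rpow_def_of_pos hx, ← Real.exp_add, ← Real.exp_add, ← Real.exp_sub]
  congr 1
  rw [Finset.sum_sub_distrib, Finset.sum_sub_distrib, ← Finset.sum_div, ← Finset.sum_mul]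
  ring

theorem productCoeffAsymptotic_prodFactor [Nonempty ι] (hs : ∀ i, 0 < s i) (ht : ∀ i, 0 < t i)
    (hgcd : ∀ d : ℕ, (∀ i, d ∣ s i ∧ d ∣ t i) → d = 1) :
    ProductCoeffAsymptotic (fun k => ∏ i, prodFactor (e i) (s i * k + t i))
      (fun n => Real.exp (∑ i, constCoeffLog (e i) (s i) (t i)) *
        (∑ i, polarCoeff (e i) (s i)) ^ (1 / 4 - (∑ i, logCoeff (e i) (s i) (t i)) / 2) /
          (2 * √π) * (n : ℝ) ^ ((∑ i, logCoeff (e i) (s i) (t i)) / 2 - 3 / 4) *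
        Real.exp (2 * √((∑ i, polarCoeff (e i) (s i)) * n))) := by
  have hN (i : ι) (k : ℕ) : 0 < s i * k + t i := Nat.add_pos_right _ (ht i)
  have h0 (k n : ℕ) : 0 ≤ coeff n (∏ i, prodFactor (e i) (s i * k + t i)) :=
    coeff_prod_nonneg (fun i _ => coeff_prodFactor_nonneg (e i) (hN i k)) n
  have h1 (k : ℕ) : (X : ℝ⟦X⟧) ^ (k + 1) ∣ ∏ i, prodFactor (e i) (s i * k + t i) - 1 := by
    refine dvd_prod_sub_one fun i _ =>
      (pow_dvd_pow X ?_).trans (X_pow_dvd_prodFactor_sub_one (e i) (hN i k))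
    have := Nat.le_mul_of_pos_left k (hs i)
    have := ht i
    omega
  obtain ⟨g, hg, hle, hlim⟩ := exists_hasProd_of_dvd_sub_one h0 h1
  refine ⟨g, hg, ?_⟩
  have hg0 (n : ℕ) : 0 ≤ coeff n g := (coeff_prod_nonneg (fun i _ => h0 i) n).trans (hle 0 n)
  have hcast (i : ι) (k : ℕ) (x : ℝ) : x * ((s i * k + t i : ℕ) : ℝ) = x * (s i * k + t i) := by
    push_cast; rfl
  have hpos (i : ι) (k : ℕ) {x : ℝ} (hx : 0 < x) : 0 < x * ((s i * k + t i : ℕ) : ℝ) :=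
    mul_pos hx (by exact_mod_cast hN i k)
  have hr1 {x : ℝ} (hx : 0 < x) : ‖((Real.exp (-x) : ℝ) : ℂ)‖ < 1 := by
    rw [Complex.norm_real, Real.norm_of_nonneg (Real.exp_pos _).le, Real.exp_lt_one_iff]
    linarith
  have hEx {x : ℝ} (hx : 0 < x) (k : ℕ) :
      HasAbsSum (∏ i, prodFactor (e i) (s i * k + t i)) ((Real.exp (-x) : ℝ) : ℂ)
        ((Real.exp (∑ i, logFactor (e i) (x * ((s i * k + t i : ℕ) : ℝ))) : ℝ) : ℂ) := by
    rw [Real.exp_sum, Complex.ofReal_prod]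
    refine HasAbsSum.prod fun i _ => ?_
    rw [← prodFactorVal_exp _ (hpos i k hx)]
    have := hasAbsSum_prodFactor (e i) (hN i k) (hr1 hx)
    rw [← Complex.ofReal_pow, ← Real.exp_nat_mul] at this
    convert this using 4
    ring
  have hprod {x : ℝ} (hx : 0 < x) : Tendsto (fun K => ∏ k ∈ Finset.range K,
      Real.exp (∑ i, logFactor (e i) (x * ((s i * k + t i : ℕ) : ℝ)))) atTop
      (𝓝 (Real.exp (∑ i, logProduct (e i) (s i) (t i) x))) := by
    simp_rw [← Real.exp_sum]
    refine (Real.continuous_exp.tendsto _).comp ?_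
    have : HasSum (fun k : ℕ => ∑ i, logFactor (e i) (x * ((s i * k + t i : ℕ) : ℝ)))
        (∑ i, logProduct (e i) (s i) (t i) x) := by
      refine hasSum_sum fun i _ => ?_
      simp_rw [hcast]
      exact hasSum_logFactor (e i) (by exact_mod_cast hs i) (by exact_mod_cast ht i) hx
    exact this.tendsto_sum_nat
  have hsr {x : ℝ} (hx : 0 < x) : Summable fun n => coeff n g * Real.exp (-x) ^ n := by
    obtain ⟨M, hM⟩ := (hprod hx).bddAbove_range
    exact summable_coeff_of_prod_le h0 hlim hle (Real.exp_pos _).le (hEx hx)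
      fun K => hM ⟨K, rfl⟩
  have hexp (x : ℝ) (n : ℕ) : Real.exp (-x) ^ n = Real.exp (-(x * n)) := by
    rw [← Real.exp_nat_mul]; congr 1; ring
  have hval {x : ℝ} (hx : 0 < x) : ∑' n, coeff n g * Real.exp (-(x * n)) =
      Real.exp (∑ i, logProduct (e i) (s i) (t i) x) := by
    have h2 := tendsto_prod_of_summable_coeff h0 hlim hle (z := ((Real.exp (-x) : ℝ) : ℂ))
      (by rw [Complex.norm_real, Real.norm_of_nonneg (Real.exp_pos _).le]; exact hsr hx) (hEx hx)
    have h3 := (Complex.continuous_ofReal.tendsto _).comp (hprod hx)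
    have h4 := tendsto_nhds_unique h2 (h3.congr fun K => by
      simp only [Function.comp]; rw [Complex.ofReal_prod])
    rw [← Complex.ofReal_inj, ← h4, Complex.ofReal_tsum]
    refine tsum_congr fun n => ?_
    rw [← hexp]; push_cast; rfl
  obtain ⟨c, hc, hmin⟩ := exists_min_le_sum_exp_mul_one_sub_cos hs hgcd
  refine isEquivalent_of_boltzmann (c := c / 5) hg0 (fun x hx => ?_) ?_ (Real.exp_pos _)
    (by positivity) ?_ ?_
  · simpa only [hexp] using hsr hx
  · exact Finset.sum_pos (fun i _ => polarCoeff_pos _ (by exact_mod_cast hs i))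
      Finset.univ_nonempty
  · refine (tendsto_exp_sum_logProduct s t e hs ht).congr' ?_
    filter_upwards [self_mem_nhdsWithin] with x (hx : 0 < x)
    rw [hval hx]
  -- The off-axis bound is proved for partial products, factor by factor, and passed to the limit.
  -- The loss `1/5` per factor turns the constant `c` of the cosine bound into `c/5`.
  · filter_upwards [Ioc_mem_nhdsGT one_pos] with x hx1 θ hθ
    have hx : 0 < x := hx1.1
    have hnz : ‖Complex.exp (-x + θ * Complex.I)‖ = Real.exp (-x) := by
      rw [Complex.norm_exp]; simp
    have hEz (k : ℕ) : HasAbsSum (∏ i, prodFactor (e i) (s i * k + t i))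
        (Complex.exp (-x + θ * Complex.I))
        (∏ i, prodFactorVal (e i) (Complex.exp (-(x * ((s i * k + t i : ℕ) : ℝ) : ℝ) +
          ((((s i * k + t i : ℕ) : ℝ) * θ : ℝ) : ℂ) * Complex.I))) := by
      refine HasAbsSum.prod fun i _ => ?_
      have := hasAbsSum_prodFactor (e i) (hN i k) (z := Complex.exp (-x + θ * Complex.I)) (by
        rw [hnz, Real.exp_lt_one_iff]; linarith)
      rw [← Complex.exp_nat_mul] at this
      convert this using 3
      push_cast; ring
    have h2 := tendsto_prod_of_summable_coeff h0 hlim hle (by rw [hnz]; exact hsr hx) hEz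
    obtain ⟨N, hNM⟩ := hmin x θ hx hx1.2 hθ
    have h3 := (hprod hx).mul_const (Real.exp (-(c / 5) * min (1 / x) (θ ^ 2 / x ^ 3)))
    rw [hval hx]
    refine le_trans (le_of_eq ?_) (le_of_tendsto_of_tendsto h2.norm h3 ?_)
    · congr 1
      refine tsum_congr fun n => ?_
      rw [← Complex.exp_nat_mul]
      congr 2; ring
    · filter_upwards [eventually_ge_atTop N] with K hK
      calc ‖∏ k ∈ Finset.range K, ∏ i, prodFactorVal (e i)
            (Complex.exp (-(x * ((s i * k + t i : ℕ) : ℝ) : ℝ) +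
              ((((s i * k + t i : ℕ) : ℝ) * θ : ℝ) : ℂ) * Complex.I))‖
          ≤ ∏ k ∈ Finset.range K, ∏ i, (Real.exp (logFactor (e i) (x * ((s i * k + t i : ℕ) : ℝ))) *
              Real.exp (-(1 / 5 * (Real.exp (-(x * ((s i * k + t i : ℕ) : ℝ))) *
                (1 - Real.cos (((s i * k + t i : ℕ) : ℝ) * θ)))))) := by
            rw [norm_prod]
            refine Finset.prod_le_prod (fun _ _ => norm_nonneg _) fun k _ => ?_
            rw [norm_prod]
            exact Finset.prod_le_prod (fun _ _ => norm_nonneg _) fun i _ =>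
              norm_prodFactorVal_le (e i) (hpos i k hx) _
        _ = (∏ k ∈ Finset.range K,
              Real.exp (∑ i, logFactor (e i) (x * ((s i * k + t i : ℕ) : ℝ)))) *
            Real.exp (-(1 / 5 * ∑ k ∈ Finset.range K, ∑ i,
              Real.exp (-(x * ((s i * k + t i : ℕ) : ℝ))) *
                (1 - Real.cos (((s i * k + t i : ℕ) : ℝ) * θ)))) := by
            simp_rw [Finset.prod_mul_distrib, ← Real.exp_sum, Finset.sum_neg_distrib,
              ← Finset.mul_sum]
        _ ≤ _ := by
            refine mul_le_mul_of_nonneg_left (Real.exp_le_exp.2 ?_)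
              (Finset.prod_nonneg fun _ _ => (Real.exp_pos _).le)
            have := hNM K hK
            linarith

end General

/-! ### Powers and convolutions -/

theorem ProductCoeffAsymptotic.congr {f f' : ℕ → ℝ⟦X⟧} {A A' : ℕ → ℝ}
    (h : ProductCoeffAsymptotic f A) (hf : ∀ k, f k = f' k)
    (hA : ∀ n : ℕ, 0 < n → A n = A' n) : ProductCoeffAsymptotic f' A' := by
  obtain rfl : f = f' := funext hf
  obtain ⟨g, hg, hgA⟩ := h
  refine ⟨g, hg, hgA.congr_right ?_⟩
  filter_upwards [eventually_gt_atTop 0] with n hn using hA n hn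

theorem two_mul_sqrt_eq_pi_mul_sqrt {u v : ℝ} (h : 4 * u = π ^ 2 * v) : 2 * √u = π * √v := by
  calc 2 * √u = √(2 ^ 2) * √u := by rw [Real.sqrt_sq two_pos.le]
    _ = √(π ^ 2) * √v := by
      rw [← Real.sqrt_mul (by positivity), ← Real.sqrt_mul (by positivity), ← h]
      norm_num
    _ = π * √v := by rw [Real.sqrt_sq pi_pos.le]

theorem inv_pow_powerSeries (p : ℝ⟦X⟧) (m : ℕ) : p⁻¹ ^ m = (p ^ m)⁻¹ := by
  induction m with
  | zero => simp
  | succ m ih => rw [pow_succ, pow_succ, PowerSeries.mul_inv_rev, ih, mul_comm]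

theorem log_const_four : Real.log 4 = 2 * Real.log 2 := by
  rw [show (4 : ℝ) = 2 ^ 2 by norm_num, Real.log_pow]; push_cast; ring

theorem log_const_six : Real.log 6 = Real.log 2 + Real.log 3 := by
  rw [← Real.log_mul two_ne_zero three_ne_zero]; norm_num

theorem log_const_twelve : Real.log 12 = 2 * Real.log 2 + Real.log 3 := by
  rw [← log_const_four, ← Real.log_mul four_ne_zero three_ne_zero]; norm_num

theorem powers_inv {s t m : ℕ} (hs : 0 < s) (ht : 0 < t) (hm : 0 < m) (hst : Nat.gcd s t = 1) :
    ProductCoeffAsymptotic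
        (fun k => ((1 - X ^ (s * k + t)) ^ m)⁻¹)
        (fun n =>
          Real.Gamma ((t : ℝ) / s) ^ m
            * (2 : ℝ) ^ (-((m : ℝ) + 5) / 4 - (m : ℝ) * t / (2 * s))
            * (3 : ℝ) ^ (((m : ℝ) - 1) / 4 - (m : ℝ) * t / (2 * s))
            * (m : ℝ) ^ (-((m : ℝ) - 1) / 4 + (m : ℝ) * t / (2 * s))
            * (s : ℝ) ^ (-((m : ℝ) + 1) / 4 + (m : ℝ) * t / (2 * s))
            * Real.pi ^ (-(m : ℝ) + (m : ℝ) * t / s)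
            * (n : ℝ) ^ (((m : ℝ) - 3) / 4 - (m : ℝ) * t / (2 * s))
            * Real.exp (Real.pi * Real.sqrt (2 * (m : ℝ) * n / (3 * s)))) := by
  have : Nonempty (Fin m) := ⟨⟨0, hm⟩⟩
  refine (productCoeffAsymptotic_prodFactor (fun _ : Fin m => s) (fun _ => t) (fun _ => true)
    (fun _ => hs) (fun _ => ht) fun d hd => ?_).congr (fun k => ?_) fun n hn => ?_
  · exact Nat.dvd_one.1 (hst ▸ Nat.dvd_gcd (hd ⟨0, hm⟩).1 (hd ⟨0, hm⟩).2)
  · simp [prodFactor, inv_pow_powerSeries]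
  · simp only [constCoeffLog, polarCoeff, logCoeff, if_true, Finset.sum_const, Finset.card_univ,
      Fintype.card_fin, nsmul_eq_mul]
    have hG : 0 < Real.Gamma ((t : ℝ) / s) := Real.Gamma_pos_of_pos (by positivity)
    have hπ := pi_pos
    rw [two_mul_sqrt_eq_pi_mul_sqrt (u := (m : ℝ) * (π ^ 2 / 6 / s) * n)
        (v := 2 * (m : ℝ) * n / (3 * s)) (by field_simp; norm_num)]
    congr 1
    -- Both prefactors are positive, so it suffices to compare logarithms; the claim becomes a
    -- linear identity in the logarithms of `2`, `3`, `m`, `s`, `π`, `n` and the Gamma value.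
    refine Real.log_injOn_pos (by simp only [Set.mem_Ioi]; positivity)
      (by simp only [Set.mem_Ioi]; positivity) ?_
    simp (disch := positivity) only [Real.log_mul, Real.log_div, Real.log_rpow, Real.log_exp,
      Real.log_pow, Real.log_sqrt, log_const_six]
    field_simp
    ring

theorem powers_one_add {s t m : ℕ} (hs : 0 < s) (ht : 0 < t) (hm : 0 < m)
    (hst : Nat.gcd s t = 1) :
    ProductCoeffAsymptotic
        (fun k => (1 + X ^ (s * k + t)) ^ m)
        (fun n =>
          (2 : ℝ) ^ (((m : ℝ) - 3) / 2 - (m : ℝ) * t / s) * (m : ℝ) ^ (1 / 4 : ℝ)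
            / ((3 * (s : ℝ)) ^ (1 / 4 : ℝ) * (n : ℝ) ^ (3 / 4 : ℝ))
            * Real.exp (Real.pi * Real.sqrt ((m : ℝ) * n / (3 * s)))) := by
  have : Nonempty (Fin m) := ⟨⟨0, hm⟩⟩
  refine (productCoeffAsymptotic_prodFactor (fun _ : Fin m => s) (fun _ => t) (fun _ => false)
    (fun _ => hs) (fun _ => ht) fun d hd => ?_).congr (fun k => ?_) fun n hn => ?_
  · exact Nat.dvd_one.1 (hst ▸ Nat.dvd_gcd (hd ⟨0, hm⟩).1 (hd ⟨0, hm⟩).2)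
  · simp [prodFactor]
  · simp only [constCoeffLog, polarCoeff, logCoeff, Bool.false_eq_true, if_false, Finset.sum_const,
      Finset.card_univ, Fintype.card_fin, nsmul_eq_mul]
    have hπ := pi_pos
    rw [two_mul_sqrt_eq_pi_mul_sqrt (u := (m : ℝ) * (π ^ 2 / 12 / s) * n)
        (v := (m : ℝ) * n / (3 * s)) (by field_simp; norm_num)]
    congr 1
    refine Real.log_injOn_pos (by simp only [Set.mem_Ioi]; positivity)
      (by simp only [Set.mem_Ioi]; positivity) ?_
    simp (disch := positivity) only [Real.log_mul, Real.log_div, Real.log_rpow, Real.log_exp,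
      Real.log_pow, Real.log_sqrt, log_const_twelve]
    field_simp
    ring

theorem powers_ratio {s t m : ℕ} (hs : 0 < s) (ht : 0 < t) (hm : 0 < m)
    (hst : Nat.gcd s t = 1) :
    ProductCoeffAsymptotic
        (fun k => ((1 + X ^ (s * k + t)) * (1 - X ^ (s * k + t))⁻¹) ^ m)
        (fun n =>
          Real.Gamma ((t : ℝ) / s) ^ m
            * (2 : ℝ) ^ ((m : ℝ) / 2 - 3 / 2 - 2 * (t : ℝ) * m / s)
            * (s : ℝ) ^ (-(m : ℝ) / 4 - 1 / 4 + (t : ℝ) * m / (2 * s))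
            * (m : ℝ) ^ (1 / 4 - (m : ℝ) / 4 + (t : ℝ) * m / (2 * s))
            * Real.pi ^ ((t : ℝ) * m / s - (m : ℝ))
            * (n : ℝ) ^ ((m : ℝ) / 4 - 3 / 4 - (t : ℝ) * m / (2 * s))
            * Real.exp (Real.pi * Real.sqrt ((m : ℝ) * n / s))) := by
  have : Nonempty (Fin m) := ⟨⟨0, hm⟩⟩
  -- The Boolean coordinate selects numerator or denominator, so each of the `m` copies contributes
  -- one factor of either kind.
  refine (productCoeffAsymptotic_prodFactor (fun _ : Fin m × Bool => s) (fun _ => t) (fun i => i.2)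
    (fun _ => hs) (fun _ => ht) fun d hd => ?_).congr (fun k => ?_) fun n hn => ?_
  · exact Nat.dvd_one.1 (hst ▸ Nat.dvd_gcd (hd (⟨0, hm⟩, true)).1 (hd (⟨0, hm⟩, true)).2)
  · simp [prodFactor, Fintype.prod_prod_type, mul_comm]
  · simp only [constCoeffLog, polarCoeff, logCoeff, Fintype.sum_prod_type, Fintype.sum_bool,
      if_true, Bool.false_eq_true, if_false, Finset.sum_const,
      Finset.card_univ, Fintype.card_fin, nsmul_eq_mul]
    have hG : 0 < Real.Gamma ((t : ℝ) / s) := Real.Gamma_pos_of_pos (by positivity)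
    have hπ := pi_pos
    rw [show (m : ℝ) * (π ^ 2 / 6 / s + π ^ 2 / 12 / s) = m * (π ^ 2 / 4 / s) by
        field_simp; norm_num,
      two_mul_sqrt_eq_pi_mul_sqrt (u := (m : ℝ) * (π ^ 2 / 4 / s) * n)
        (v := (m : ℝ) * n / s) (by field_simp)]
    congr 1
    refine Real.log_injOn_pos (by simp only [Set.mem_Ioi]; positivity)
      (by simp only [Set.mem_Ioi]; positivity) ?_
    simp (disch := positivity) only [Real.log_mul, Real.log_div, Real.log_rpow, Real.log_exp,
      Real.log_pow, Real.log_sqrt, log_const_four]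
    field_simp
    ring

theorem eq_one_of_forall_bool_dvd {s t c d : ℕ} (h : Nat.gcd (Nat.gcd s t) (Nat.gcd c d) = 1)
    {a : ℕ} (ha : ∀ b : Bool, a ∣ cond b s c ∧ a ∣ cond b t d) : a = 1 :=
  Nat.dvd_one.1 (h ▸ Nat.dvd_gcd (Nat.dvd_gcd (ha true).1 (ha true).2)
    (Nat.dvd_gcd (ha false).1 (ha false).2))

theorem forall_bool_cond_pos {s c : ℕ} (hs : 0 < s) (hc : 0 < c) (b : Bool) : 0 < cond b s c := by
  cases b <;> assumption

theorem convolution_inv {s t c d : ℕ} (hs : 0 < s) (ht : 0 < t) (hc : 0 < c) (hd : 0 < d)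
    (hgcd : Nat.gcd (Nat.gcd s t) (Nat.gcd c d) = 1) :
    ProductCoeffAsymptotic
        (fun k => ((1 - X ^ (s * k + t)) * (1 - X ^ (c * k + d)))⁻¹)
        (fun n =>
          Real.Gamma ((t : ℝ) / s) * Real.Gamma ((d : ℝ) / c)
            * (s : ℝ) ^ ((t : ℝ) / (2 * s) - (d : ℝ) / (2 * c) - 1 / 4)
            * (c : ℝ) ^ ((d : ℝ) / (2 * c) - (t : ℝ) / (2 * s) - 1 / 4)
            * ((s : ℝ) + c) ^ ((t : ℝ) / (2 * s) + (d : ℝ) / (2 * c) - 1 / 4)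
            * Real.pi ^ ((t : ℝ) / s + (d : ℝ) / c - 2)
            / ((2 : ℝ) ^ ((t : ℝ) / (2 * s) + (d : ℝ) / (2 * c) + 7 / 4)
              * (3 : ℝ) ^ ((t : ℝ) / (2 * s) + (d : ℝ) / (2 * c) - 1 / 4)
              * (n : ℝ) ^ (1 / 4 + (t : ℝ) / (2 * s) + (d : ℝ) / (2 * c)))
            * Real.exp (Real.pi * Real.sqrt ((1 / (s : ℝ) + 1 / (c : ℝ)) * (2 * n / 3)))) := by
  refine (productCoeffAsymptotic_prodFactor (fun b => cond b s c) (fun b => cond b t d)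
    (fun _ => true) (forall_bool_cond_pos hs hc) (forall_bool_cond_pos ht hd)
    fun a ha => eq_one_of_forall_bool_dvd hgcd ha).congr (fun k => ?_) fun n hn => ?_
  · simp [prodFactor, mul_comm]
  · simp only [constCoeffLog, polarCoeff, logCoeff, Fintype.sum_bool, cond_true, cond_false,
      if_true]
    have hG : 0 < Real.Gamma ((t : ℝ) / s) := Real.Gamma_pos_of_pos (by positivity)
    have hG' : 0 < Real.Gamma ((d : ℝ) / c) := Real.Gamma_pos_of_pos (by positivity)
    have hπ := pi_pos
    rw [show π ^ 2 / 6 / (s : ℝ) + π ^ 2 / 6 / c = π ^ 2 * (s + c) / 6 / s / c by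
        field_simp; ring,
      two_mul_sqrt_eq_pi_mul_sqrt (u := π ^ 2 * ((s : ℝ) + c) / 6 / s / c * n)
        (v := (1 / (s : ℝ) + 1 / (c : ℝ)) * (2 * n / 3))
        (by field_simp; ring)]
    congr 1
    refine Real.log_injOn_pos (by simp only [Set.mem_Ioi]; positivity)
      (by simp only [Set.mem_Ioi]; positivity) ?_
    simp (disch := positivity) only [Real.log_mul, Real.log_div, Real.log_rpow, Real.log_exp,
      Real.log_pow, Real.log_sqrt, log_const_six]
    field_simp
    ring

theorem convolution_one_add {s t c d : ℕ} (hs : 0 < s) (ht : 0 < t) (hc : 0 < c) (hd : 0 < d)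
    (hgcd : Nat.gcd (Nat.gcd s t) (Nat.gcd c d) = 1) :
    ProductCoeffAsymptotic
        (fun k => (1 + X ^ (s * k + t)) * (1 + X ^ (c * k + d)))
        (fun n =>
          ((s : ℝ) + c) ^ (1 / 4 : ℝ)
            / ((2 : ℝ) ^ (1 / 2 + (t : ℝ) / s + (d : ℝ) / c)
              * (3 * (s : ℝ) * c) ^ (1 / 4 : ℝ) * (n : ℝ) ^ (3 / 4 : ℝ))
            * Real.exp (Real.pi * Real.sqrt ((1 / (s : ℝ) + 1 / (c : ℝ)) * (n / 3)))) := by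
  refine (productCoeffAsymptotic_prodFactor (fun b => cond b s c) (fun b => cond b t d)
    (fun _ => false) (forall_bool_cond_pos hs hc) (forall_bool_cond_pos ht hd)
    fun a ha => eq_one_of_forall_bool_dvd hgcd ha).congr (fun k => ?_) fun n hn => ?_
  · simp [prodFactor]
  · simp only [constCoeffLog, polarCoeff, logCoeff, Fintype.sum_bool, cond_true, cond_false,
      Bool.false_eq_true, if_false]
    have hπ := pi_pos
    rw [show π ^ 2 / 12 / (s : ℝ) + π ^ 2 / 12 / c = π ^ 2 * (s + c) / 12 / s / c by
        field_simp; ring,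
      two_mul_sqrt_eq_pi_mul_sqrt (u := π ^ 2 * ((s : ℝ) + c) / 12 / s / c * n)
        (v := (1 / (s : ℝ) + 1 / (c : ℝ)) * (n / 3))
        (by field_simp; ring)]
    congr 1
    refine Real.log_injOn_pos (by simp only [Set.mem_Ioi]; positivity)
      (by simp only [Set.mem_Ioi]; positivity) ?_
    simp (disch := positivity) only [Real.log_mul, Real.log_div, Real.log_rpow, Real.log_exp,
      Real.log_pow, Real.log_sqrt, log_const_twelve]
    field_simp
    ring

theorem convolution_ratio {s t c d : ℕ} (hs : 0 < s) (ht : 0 < t) (hc : 0 < c) (hd : 0 < d)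
    (hgcd : Nat.gcd (Nat.gcd s t) (Nat.gcd c d) = 1) :
    ProductCoeffAsymptotic
        (fun k => (1 + X ^ (s * k + t)) * (1 - X ^ (c * k + d))⁻¹)
        (fun n =>
          (c : ℝ) ^ ((d : ℝ) / (2 * c) - 1 / 2)
            * ((c : ℝ) + 2 * s) ^ ((d : ℝ) / (2 * c))
            * Real.pi ^ ((d : ℝ) / c - 1) * Real.Gamma ((d : ℝ) / c)
            / ((2 : ℝ) ^ ((d : ℝ) / c + ((s : ℝ) + t) / s)
              * (3 : ℝ) ^ ((d : ℝ) / (2 * c)) * (s : ℝ) ^ ((d : ℝ) / (2 * c))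
              * (n : ℝ) ^ (((c : ℝ) + d) / (2 * c)))
            * Real.exp (Real.pi * Real.sqrt ((2 / (c : ℝ) + 1 / (s : ℝ)) * (n / 3)))) := by
  refine (productCoeffAsymptotic_prodFactor (fun b => cond b s c) (fun b => cond b t d)
    (fun b => !b) (forall_bool_cond_pos hs hc) (forall_bool_cond_pos ht hd)
    fun a ha => eq_one_of_forall_bool_dvd hgcd ha).congr (fun k => ?_) fun n hn => ?_
  · simp [prodFactor]
  · simp only [constCoeffLog, polarCoeff, logCoeff, Fintype.sum_bool, cond_true, cond_false,
      Bool.not_true, Bool.not_false, if_true, Bool.false_eq_true, if_false]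
    have hG' : 0 < Real.Gamma ((d : ℝ) / c) := Real.Gamma_pos_of_pos (by positivity)
    have hπ := pi_pos
    rw [show π ^ 2 / 12 / (s : ℝ) + π ^ 2 / 6 / c = π ^ 2 * (c + 2 * s) / 12 / s / c by
        field_simp; ring,
      two_mul_sqrt_eq_pi_mul_sqrt (u := π ^ 2 * ((c : ℝ) + 2 * s) / 12 / s / c * n)
        (v := (2 / (c : ℝ) + 1 / (s : ℝ)) * (n / 3))
        (by field_simp; ring)]
    congr 1
    refine Real.log_injOn_pos (by simp only [Set.mem_Ioi]; positivity)
      (by simp only [Set.mem_Ioi]; positivity) ?_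
    simp (disch := positivity) only [Real.log_mul, Real.log_div, Real.log_rpow, Real.log_exp,
      Real.log_pow, Real.log_sqrt, log_const_twelve]
    field_simp
    ring

theorem mainTheorem6 :
    (∀ s t m : ℕ, 0 < s → 0 < t → 0 < m → Nat.gcd s t = 1 →
      ProductCoeffAsymptotic
        (fun k => ((1 - X ^ (s * k + t)) ^ m)⁻¹)
        (fun n =>
          Real.Gamma ((t : ℝ) / s) ^ m
            * (2 : ℝ) ^ (-((m : ℝ) + 5) / 4 - (m : ℝ) * t / (2 * s))
            * (3 : ℝ) ^ (((m : ℝ) - 1) / 4 - (m : ℝ) * t / (2 * s))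
            * (m : ℝ) ^ (-((m : ℝ) - 1) / 4 + (m : ℝ) * t / (2 * s))
            * (s : ℝ) ^ (-((m : ℝ) + 1) / 4 + (m : ℝ) * t / (2 * s))
            * Real.pi ^ (-(m : ℝ) + (m : ℝ) * t / s)
            * (n : ℝ) ^ (((m : ℝ) - 3) / 4 - (m : ℝ) * t / (2 * s))
            * Real.exp (Real.pi * Real.sqrt (2 * (m : ℝ) * n / (3 * s)))) ∧
      ProductCoeffAsymptotic
        (fun k => (1 + X ^ (s * k + t)) ^ m)
        (fun n =>
          (2 : ℝ) ^ (((m : ℝ) - 3) / 2 - (m : ℝ) * t / s) * (m : ℝ) ^ (1 / 4 : ℝ)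
            / ((3 * (s : ℝ)) ^ (1 / 4 : ℝ) * (n : ℝ) ^ (3 / 4 : ℝ))
            * Real.exp (Real.pi * Real.sqrt ((m : ℝ) * n / (3 * s)))) ∧
      ProductCoeffAsymptotic
        (fun k => ((1 + X ^ (s * k + t)) * (1 - X ^ (s * k + t))⁻¹) ^ m)
        (fun n =>
          Real.Gamma ((t : ℝ) / s) ^ m
            * (2 : ℝ) ^ ((m : ℝ) / 2 - 3 / 2 - 2 * (t : ℝ) * m / s)
            * (s : ℝ) ^ (-(m : ℝ) / 4 - 1 / 4 + (t : ℝ) * m / (2 * s))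
            * (m : ℝ) ^ (1 / 4 - (m : ℝ) / 4 + (t : ℝ) * m / (2 * s))
            * Real.pi ^ ((t : ℝ) * m / s - (m : ℝ))
            * (n : ℝ) ^ ((m : ℝ) / 4 - 3 / 4 - (t : ℝ) * m / (2 * s))
            * Real.exp (Real.pi * Real.sqrt ((m : ℝ) * n / s)))) ∧
    (∀ s t c d : ℕ, 0 < s → 0 < t → 0 < c → 0 < d →
        Nat.gcd (Nat.gcd s t) (Nat.gcd c d) = 1 →
      ProductCoeffAsymptotic
        (fun k => ((1 - X ^ (s * k + t)) * (1 - X ^ (c * k + d)))⁻¹)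
        (fun n =>
          Real.Gamma ((t : ℝ) / s) * Real.Gamma ((d : ℝ) / c)
            * (s : ℝ) ^ ((t : ℝ) / (2 * s) - (d : ℝ) / (2 * c) - 1 / 4)
            * (c : ℝ) ^ ((d : ℝ) / (2 * c) - (t : ℝ) / (2 * s) - 1 / 4)
            * ((s : ℝ) + c) ^ ((t : ℝ) / (2 * s) + (d : ℝ) / (2 * c) - 1 / 4)
            * Real.pi ^ ((t : ℝ) / s + (d : ℝ) / c - 2)
            / ((2 : ℝ) ^ ((t : ℝ) / (2 * s) + (d : ℝ) / (2 * c) + 7 / 4)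
              * (3 : ℝ) ^ ((t : ℝ) / (2 * s) + (d : ℝ) / (2 * c) - 1 / 4)
              * (n : ℝ) ^ (1 / 4 + (t : ℝ) / (2 * s) + (d : ℝ) / (2 * c)))
            * Real.exp (Real.pi * Real.sqrt ((1 / (s : ℝ) + 1 / (c : ℝ)) * (2 * n / 3)))) ∧
      ProductCoeffAsymptotic
        (fun k => (1 + X ^ (s * k + t)) * (1 + X ^ (c * k + d)))
        (fun n =>
          ((s : ℝ) + c) ^ (1 / 4 : ℝ)
            / ((2 : ℝ) ^ (1 / 2 + (t : ℝ) / s + (d : ℝ) / c)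
              * (3 * (s : ℝ) * c) ^ (1 / 4 : ℝ) * (n : ℝ) ^ (3 / 4 : ℝ))
            * Real.exp (Real.pi * Real.sqrt ((1 / (s : ℝ) + 1 / (c : ℝ)) * (n / 3)))) ∧
      ProductCoeffAsymptotic
        (fun k => (1 + X ^ (s * k + t)) * (1 - X ^ (c * k + d))⁻¹)
        (fun n =>
          (c : ℝ) ^ ((d : ℝ) / (2 * c) - 1 / 2)
            * ((c : ℝ) + 2 * s) ^ ((d : ℝ) / (2 * c))
            * Real.pi ^ ((d : ℝ) / c - 1) * Real.Gamma ((d : ℝ) / c)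
            / ((2 : ℝ) ^ ((d : ℝ) / c + ((s : ℝ) + t) / s)
              * (3 : ℝ) ^ ((d : ℝ) / (2 * c)) * (s : ℝ) ^ ((d : ℝ) / (2 * c))
              * (n : ℝ) ^ (((c : ℝ) + d) / (2 * c)))
            * Real.exp (Real.pi * Real.sqrt ((2 / (c : ℝ) + 1 / (s : ℝ)) * (n / 3))))) := by
  exact ⟨fun s t m hs ht hm h => ⟨powers_inv hs ht hm h, powers_one_add hs ht hm h,
      powers_ratio hs ht hm h⟩,
    fun s t c d hs ht hc hd h => ⟨convolution_inv hs ht hc hd h, convolution_one_add hs ht hc hd h,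
      convolution_ratio hs ht hc hd h⟩⟩
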